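/- Let $\mathbb F\in\{\mathbb R,\mathbb C\}$, let $^\star$ denote the conjugate transpose (the transpose if $\mathbb F=\mathbb R$), and let $E,Q,J,R\in\mathbb F^{n\times n}$ satisfy $$J^\star=-J,\qquad R^\star=R\ge 0,\qquad E^\star Q=Q^\star E\ge 0 .$$ Put $L=J-R$ and assume that the pencil $P(\lambda)=\lambda E-LQ$ is regular ($\det P(\lambda_0)\neq0$ for some $\lambda_0\in\mathbb C$) and of index at most one (all blocks for the eigenvalue $\infty$ in its Kronecker canonical form over $\mathbb C$ have size at most one). Let a partition $n=n_1+n_2+n_3+n_4$, a unitary $\widetilde U\in\mathbb F^{n\times n}$ and an invertible $\widetilde X\in\mathbb F^{n\times n}$ be given such that, conformably with this partition, $$\widetilde Q:=\widetilde UQ\widetilde X=\begin{pmatrix}Q_{11}&Q_{12}&0&0\\Q_{21}&Q_{22}&0&0\\0&0&0&0\\Q_{41}&Q_{42}&0&I\end{pmatrix},\quad \widetilde UE\widetilde X=\begin{pmatrix}E_{11}&0&0&0\\E_{21}&E_{22}&0&0\\0&0&I&0\\0&0&0&0\end{pmatrix},\quad \widetilde ULQ\widetilde X=\begin{pmatrix}A_{11}&0&0&A_{14}\\A_{21}&0&0&A_{24}\\A_{31}&A_{32}&0&A_{34}\\0&0&0&A_{44}\end{pmatrix},$$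 where $E_{11}$, $E_{22}$, $A_{11}$, $A_{44}$ and $\begin{pmatrix}Q_{11}&Q_{12}\\Q_{21}&Q_{22}\end{pmatrix}$ are invertible. Write $\widetilde UL\widetilde U^\star=(L_{ij})_{i,j=1}^4$, $\widetilde UR\widetilde U^\star=(R_{ij})_{i,j=1}^4$ and $$R_0=\begin{pmatrix}R_{11}&R_{12}&R_{14}\\R_{21}&R_{22}&R_{24}\\R_{41}&R_{42}&R_{44}\end{pmatrix},\qquad L_3=\begin{pmatrix}L_{31}&L_{32}&L_{33}&L_{34}\end{pmatrix},\qquad Q_2=\begin{pmatrix}Q_{12}\\Q_{22}\\0\\Q_{42}\end{pmatrix}.$$ Let $\|\cdot\|$ be the spectral norm, $\|\cdot\|_F$ the Frobenius norm, $P_{\mathcal X}$ the orthogonal projection onto the subspace $\mathcal X$, and $R_0|_{\operatorname{im}R_0}$ the (invertible, positive definite) restriction of $R_0$ to its image. Then for every $Y=\begin{pmatrix}Y_1&Y_2&Y_4\end{pmatrix}\in\mathbb F^{n_3\times(n_1+n_2+n_4)}$ with $\operatorname{im}Y^\star\subseteq\operatorname{im}R_0$, setting $\widehat Y=\begin{pmatrix}Y_1&Y_2&0&Y_4\end{pmatrix}\in\mathbb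 F^{n_3\times n}$, there exist $\Delta_R=\Delta_R^\star\in\mathbb F^{n\times n}$ with $R+\Delta_R\ge0$ and $$\|\Delta_R\|\le 2\|Y\|+\Big(\big\|(R_0|_{\operatorname{im}R_0})^{-1}\big\|\,\|Y\|+2\big\|(R_0|_{\operatorname{im}R_0})^{-1/2}\big\|\,\|Y\|^{1/2}\Big)\big(\|R_{33}\|+\|Y\|\big),$$ and $\Delta_J=-\Delta_J^\star\in\mathbb F^{n\times n}$ with $$\|\Delta_J\|_F\le 2\,\big\|P_{\operatorname{im}Q_2}\big(L_3^\star+\widehat Y^\star\big)\big\|_F,$$ such that: - for all $s,t\in\mathbb C$ the pencil $\lambda E-(J+s\Delta_J-R-t\Delta_R)Q$ is regular, and its Kronecker canonical form over $\mathbb C$ has the same blocks (types and sizes, with multiplicity) for the nonzero eigenvalues, including $\infty$, as that of $P(\lambda)$; - for $s=t=1$, zero is an eigenvalue of $\lambda E-(J+\Delta_J-R-\Delta_R)Q$ if and only if it is an eigenvalue of $P(\lambda)$, and in that case it is a semisimple eigenvalue of $\lambda E-(J+\Delta_J-R-\Delta_R)Q$ (all its Jordan blocks in the Kronecker canonical form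 have size one). -/

import Mathlib

namespace PHPencil

/-! ### Matrices over `𝕜 = ℝ` or `ℂ` -/

/-- The complex matrix with the same entries as the matrix `A` over `𝕜 = ℝ` or `ℂ`. -/
def cplx {𝕜 m n : Type*} [RCLike 𝕜] (A : Matrix m n 𝕜) : Matrix m n ℂ :=
  A.map fun z => ⟨RCLike.re z, RCLike.im z⟩

/-- A matrix, with possibly different row and column index types, is invertible if it has a
two-sided inverse. -/
def IsInvertible {R m n : Type*} [CommRing R] [Fintype m] [Fintype n] [DecidableEq m]
    [DecidableEq n] (M : Matrix m n R) : Prop :=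
  ∃ N : Matrix n m R, M * N = 1 ∧ N * M = 1

/-- The operator norm of a linear map between finite-dimensional normed spaces. -/
noncomputable def linNorm {𝕜 V W : Type*} [RCLike 𝕜] [NormedAddCommGroup V] [NormedSpace 𝕜 V]
    [FiniteDimensional 𝕜 V] [NormedAddCommGroup W] [NormedSpace 𝕜 W] (f : V →ₗ[𝕜] W) : ℝ :=
  ‖LinearMap.toContinuousLinearMap f‖

/-- The operator norm of a matrix with respect to the Euclidean norms (the spectral norm). -/
noncomputable def opNorm {𝕜 m n : Type*} [RCLike 𝕜] [Fintype m] [Fintype n] [DecidableEq n]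
    (A : Matrix m n 𝕜) : ℝ :=
  linNorm (Matrix.toEuclideanLin A)

/-- The Frobenius norm of a matrix. -/
noncomputable def frobNorm {𝕜 m n : Type*} [RCLike 𝕜] [Fintype m] [Fintype n]
    (A : Matrix m n 𝕜) : ℝ :=
  √(∑ i, ∑ j, ‖A i j‖ ^ 2)

/-- The image of a matrix, as a subspace of Euclidean space. -/
noncomputable def im {𝕜 m n : Type*} [RCLike 𝕜] [Fintype m] [Fintype n] [DecidableEq n]
    (A : Matrix m n 𝕜) : Submodule 𝕜 (EuclideanSpace 𝕜 m) :=
  LinearMap.range (Matrix.toEuclideanLin A)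

/-- The matrix of the orthogonal projection onto a subspace. -/
noncomputable def projMatrix {𝕜 m : Type*} [RCLike 𝕜] [Fintype m] [DecidableEq m]
    (V : Submodule 𝕜 (EuclideanSpace 𝕜 m)) : Matrix m m 𝕜 :=
  Matrix.toEuclideanLin.symm V.starProjection.toLinearMap

/-- The restriction `A|_{im A} : im A → im A` of a square matrix to its image. -/
noncomputable def restrictIm {𝕜 m : Type*} [RCLike 𝕜] [Fintype m] [DecidableEq m]
    (A : Matrix m m 𝕜) : Module.End 𝕜 (im A) :=
  (Matrix.toEuclideanLin A).restrict fun x _ => LinearMap.mem_range_self _ x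

/-- For a Hermitian matrix the restriction to the image is bijective. -/
theorem isUnit_restrictIm {𝕜 m : Type*} [RCLike 𝕜] [Fintype m] [DecidableEq m]
    {A : Matrix m m 𝕜} (hA : A.IsHermitian) : IsUnit (restrictIm A) := by
  have hs : (Matrix.toEuclideanLin A).IsSymmetric := Matrix.isSymmetric_toEuclideanLin_iff.mpr hA
  rw [LinearMap.isUnit_iff_ker_eq_bot, LinearMap.ker_eq_bot']
  rintro ⟨x, y, rfl⟩ hx
  have h0 : Matrix.toEuclideanLin A (Matrix.toEuclideanLin A y) = 0 := congrArg Subtype.val hx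
  have h1 : inner 𝕜 (Matrix.toEuclideanLin A y) (Matrix.toEuclideanLin A y) = 0 := by
    rw [hs, h0, inner_zero_right]
  exact Subtype.ext (inner_self_eq_zero.mp h1)

/-- The operator norm `‖(A|_{im A})⁻¹‖` of the inverse of the restriction of `A` to its image. It is
used for positive semidefinite `A`, where the restriction is invertible; the norm is `0` for
`A = 0`. -/
noncomputable def normInvOnIm {𝕜 m : Type*} [RCLike 𝕜] [Fintype m] [DecidableEq m]
    (A : Matrix m m 𝕜) : ℝ :=
  linNorm (Ring.inverse (restrictIm A))

section

open scoped MatrixOrder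

/-- The positive semidefinite square root of a positive semidefinite matrix. Since
`im A = im (A ^ (1/2))`, the norm `‖(A|_{im A})^(-1/2)‖` is `normInvOnIm (psdSqrt A)`. -/
noncomputable def psdSqrt {𝕜 m : Type*} [RCLike 𝕜] [Fintype m] [DecidableEq m]
    (A : Matrix m m 𝕜) : Matrix m m 𝕜 :=
  CFC.sqrt A

end

/-! ### Matrix pencils `λ E - A` and the Kronecker canonical form -/

/-- The kinds of blocks in the Kronecker canonical form. -/
inductive KBlock : Type
  /-- The block of size `ε × (ε + 1)` of a right minimal index. -/
  | right (ε : ℕ)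
  /-- The block of size `(η + 1) × η` of a left minimal index. -/
  | left (η : ℕ)
  /-- The Jordan block of size `ρ × ρ` for the finite eigenvalue `μ`. -/
  | jordan (μ : ℂ) (ρ : ℕ+)
  /-- The nilpotent block of size `σ × σ` for the eigenvalue `∞`. -/
  | nilp (σ : ℕ+)

namespace KBlock

/-- Number of rows. -/
def rows : KBlock → ℕ
  | right ε => ε
  | left η => η + 1
  | jordan _ ρ => ρ
  | nilp σ => σ

/-- Number of columns. -/
def cols : KBlock → ℕ
  | right ε => ε + 1
  | left η => η
  | jordan _ ρ => ρ
  | nilp σ => σ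

/-- The coefficient `E` of the block `λ E - A`. -/
def coeffE : (b : KBlock) → Matrix (Fin b.rows) (Fin b.cols) ℂ
  | right _ => Matrix.of fun i j => if j.val = i.val then 1 else 0
  | left _ => Matrix.of fun i j => if i.val = j.val then 1 else 0
  | jordan _ _ => Matrix.of fun i j => if i.val = j.val then 1 else 0
  | nilp _ => Matrix.of fun i j => if j.val = i.val + 1 then 1 else 0

/-- The coefficient `A` of the block `λ E - A`. -/
def coeffA : (b : KBlock) → Matrix (Fin b.rows) (Fin b.cols) ℂ
  | right _ => Matrix.of fun i j => if j.val = i.val + 1 then 1 else 0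
  | left _ => Matrix.of fun i j => if i.val = j.val + 1 then 1 else 0
  | jordan μ _ => Matrix.of fun i j =>
      if i.val = j.val then μ else if j.val = i.val + 1 then 1 else 0
  | nilp _ => Matrix.of fun i j => if i.val = j.val then 1 else 0

end KBlock

/-- The list of blocks `K` is a Kronecker canonical form of `λ E - A`: there are invertible complex
matrices `S`, `T` such that `S (λ E - A) T` is the block diagonal pencil with diagonal blocks `K`. -/
def IsKCF {m n : Type*} [Fintype m] [Fintype n] [DecidableEq m] [DecidableEq n]
    (E A : Matrix m n ℂ) (K : List KBlock) : Prop :=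
  ∃ (S : Matrix (Σ i : Fin K.length, Fin (K.get i).rows) m ℂ)
    (T : Matrix n (Σ i : Fin K.length, Fin (K.get i).cols) ℂ),
    IsInvertible S ∧ IsInvertible T ∧
    S * E * T = Matrix.blockDiagonal' (fun i => (K.get i).coeffE) ∧
    S * A * T = Matrix.blockDiagonal' (fun i => (K.get i).coeffA)

/-- The square pencil `λ E - A` is regular. -/
def IsRegular {n : Type*} [Fintype n] [DecidableEq n] (E A : Matrix n n ℂ) : Prop :=
  ∃ μ : ℂ, (μ • E - A).det ≠ 0

/-- The index of `λ E - A` (largest size of a nilpotent block in the Kronecker canonical form, and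
zero if there is no such block) is at most `ν`. -/
def IndexAtMost {m n : Type*} [Fintype m] [Fintype n] [DecidableEq m] [DecidableEq n]
    (E A : Matrix m n ℂ) (ν : ℕ) : Prop :=
  ∃ K, IsKCF E A K ∧ ∀ σ, KBlock.nilp σ ∈ K → (σ : ℕ) ≤ ν

/-- `μ ∈ ℂ` is a finite eigenvalue of `λ E - A`: the rank of `μ E - A` is smaller than the normal
rank of the pencil. -/
def IsEigenvalue {m n : Type*} [Fintype m] [Fintype n] [DecidableEq m] [DecidableEq n]
    (E A : Matrix m n ℂ) (μ : ℂ) : Prop :=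
  ∃ α : ℂ, (μ • E - A).rank < (α • E - A).rank

/-- `μ` is a semisimple eigenvalue of `λ E - A`: it is an eigenvalue, and all its blocks in the
Kronecker canonical form have size one. -/
def IsSemisimpleEigenvalue {m n : Type*} [Fintype m] [Fintype n] [DecidableEq m] [DecidableEq n]
    (E A : Matrix m n ℂ) (μ : ℂ) : Prop :=
  IsEigenvalue E A μ ∧ ∃ K, IsKCF E A K ∧ ∀ ρ, KBlock.jordan μ ρ ∈ K → ρ = 1

/-- The two pencils `λ E - A` and `λ E' - A'` have the same Kronecker structure except for the
eigenvalue zero: the Kronecker canonical forms consist of common blocks `N`, none of which is a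
Jordan block for the eigenvalue `0`, and of Jordan blocks `Z` and `Z'` for the eigenvalue `0`.
For regular pencils `N` is the Kronecker structure of the nonzero eigenvalues, including `∞`. -/
def SameNonzeroKroneckerStructure {m n : Type*} [Fintype m] [Fintype n] [DecidableEq m]
    [DecidableEq n] (E A E' A' : Matrix m n ℂ) : Prop :=
  ∃ N Z Z' : List KBlock,
    (∀ b ∈ N, ∀ ρ, b ≠ KBlock.jordan 0 ρ) ∧
    (∀ b ∈ Z, ∃ ρ, b = KBlock.jordan 0 ρ) ∧
    (∀ b ∈ Z', ∃ ρ, b = KBlock.jordan 0 ρ) ∧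
    IsKCF E A (N ++ Z) ∧ IsKCF E' A' (N ++ Z')

/-! ### The condensed form -/

/-- Index set partitioned into four groups of sizes `n₁ = d 0`, `n₂ = d 1`, `n₃ = d 2`,
`n₄ = d 3`. -/
abbrev Idx (d : Fin 4 → ℕ) : Type := Σ i : Fin 4, Fin (d i)

/-- The indices that do not lie in the third group. -/
abbrev Idx124 (d : Fin 4 → ℕ) : Type := {p : Idx d // p.1 ≠ 2}

/-- The block in block row `i` and block column `j`, where `i`, `j` run from `0` to `3`. -/
def blk {R : Type*} {d : Fin 4 → ℕ} (M : Matrix (Idx d) (Idx d) R) (i j : Fin 4) :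
    Matrix (Fin (d i)) (Fin (d j)) R :=
  M.submatrix (fun k => ⟨i, k⟩) (fun k => ⟨j, k⟩)

/-- `U` is unitary, `X` is invertible, and they transform `(E, Q, L)` to the condensed form
```
       Q₁₁ Q₁₂ 0 0             E₁₁  0  0 0               A₁₁  0  0 A₁₄
UQX =  Q₂₁ Q₂₂ 0 0 ,    UEX =  E₂₁ E₂₂ 0 0 ,    ULQX =   A₂₁  0  0 A₂₄
        0   0  0 0              0   0  I 0               A₃₁ A₃₂ 0 A₃₄
       Q₄₁ Q₄₂ 0 I              0   0  0 0                0   0  0 A₄₄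
```
with invertible `E₁₁`, `E₂₂`, `A₁₁`, `A₄₄` and `[Q₁₁ Q₁₂; Q₂₁ Q₂₂]`. The blocks `E₁₁`, `E₂₂` and
`A₁₁` may be lower triangular but need not be. -/
structure IsCondensedForm {𝕜 : Type*} [RCLike 𝕜] {n : ℕ} (E Q L : Matrix (Fin n) (Fin n) 𝕜)
    (d : Fin 4 → ℕ) (U : Matrix (Idx d) (Fin n) 𝕜) (X : Matrix (Fin n) (Idx d) 𝕜) : Prop where
  unitary : U * U.conjTranspose = 1 ∧ U.conjTranspose * U = 1
  invertible : IsInvertible X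
  -- the zero blocks and the identity block of `UQX`
  Q_row1 : blk (U * Q * X) 0 2 = 0 ∧ blk (U * Q * X) 0 3 = 0
  Q_row2 : blk (U * Q * X) 1 2 = 0 ∧ blk (U * Q * X) 1 3 = 0
  Q_row3 : ∀ j, blk (U * Q * X) 2 j = 0
  Q_row4 : blk (U * Q * X) 3 2 = 0 ∧ blk (U * Q * X) 3 3 = 1
  -- the zero blocks and the identity block of `UEX`
  E_row1 : blk (U * E * X) 0 1 = 0 ∧ blk (U * E * X) 0 2 = 0 ∧ blk (U * E * X) 0 3 = 0
  E_row2 : blk (U * E * X) 1 2 = 0 ∧ blk (U * E * X) 1 3 = 0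
  E_row3 : blk (U * E * X) 2 0 = 0 ∧ blk (U * E * X) 2 1 = 0 ∧ blk (U * E * X) 2 2 = 1 ∧
    blk (U * E * X) 2 3 = 0
  E_row4 : ∀ j, blk (U * E * X) 3 j = 0
  -- the zero blocks of `ULQX`
  A_row1 : blk (U * (L * Q) * X) 0 1 = 0 ∧ blk (U * (L * Q) * X) 0 2 = 0
  A_row2 : blk (U * (L * Q) * X) 1 1 = 0 ∧ blk (U * (L * Q) * X) 1 2 = 0
  A_row3 : blk (U * (L * Q) * X) 2 2 = 0
  A_row4 : blk (U * (L * Q) * X) 3 0 = 0 ∧ blk (U * (L * Q) * X) 3 1 = 0 ∧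
    blk (U * (L * Q) * X) 3 2 = 0
  -- the invertible blocks
  E11 : IsInvertible (blk (U * E * X) 0 0)
  E22 : IsInvertible (blk (U * E * X) 1 1)
  A11 : IsInvertible (blk (U * (L * Q) * X) 0 0)
  A44 : IsInvertible (blk (U * (L * Q) * X) 3 3)
  Q12 : IsInvertible (Matrix.fromBlocks (blk (U * Q * X) 0 0) (blk (U * Q * X) 0 1)
    (blk (U * Q * X) 1 0) (blk (U * Q * X) 1 1))

/-- The principal submatrix of `M` formed by the blocks `Mᵢⱼ`, `i, j ∈ {1, 2, 4}`. -/
def sub124 {R : Type*} {d : Fin 4 → ℕ} (M : Matrix (Idx d) (Idx d) R) :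
    Matrix (Idx124 d) (Idx124 d) R :=
  M.submatrix Subtype.val Subtype.val

/-- The third block row `[M₃₁ M₃₂ M₃₃ M₃₄]`. -/
def row3 {R : Type*} {d : Fin 4 → ℕ} (M : Matrix (Idx d) (Idx d) R) :
    Matrix (Fin (d 2)) (Idx d) R :=
  M.submatrix (fun k => ⟨2, k⟩) id

/-- The second block column `[M₁₂; M₂₂; M₃₂; M₄₂]`. -/
def col2 {R : Type*} {d : Fin 4 → ℕ} (M : Matrix (Idx d) (Idx d) R) :
    Matrix (Idx d) (Fin (d 1)) R :=
  M.submatrix id (fun k => ⟨1, k⟩)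

/-- The matrix `[Y₁ Y₂ 0 Y₄]` for `Y = [Y₁ Y₂ Y₄]`. -/
def padRow {R : Type*} [Zero R] {d : Fin 4 → ℕ} (Y : Matrix (Fin (d 2)) (Idx124 d) R) :
    Matrix (Fin (d 2)) (Idx d) R :=
  Matrix.of fun i p => if h : p.1 ≠ 2 then Y i ⟨p, h⟩ else 0

end PHPencil

/-! In the condensed coordinates, order the index groups as 1, 4 | 2, 3. The pencil becomes block
lower triangular: the first diagonal block is `λ E₀ - A₀` with `E₀ = diag(E₁₁, 0)` and `A₀ = [A₁₁
A₁₄; 0 A₄₄]` invertible, the second is `λ diag(E₂₂, I) - [0 0; B 0]` with `B = A₃₂ = L₃ Q₂`. After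
normalizing `E₂₂`, the coupling block can be eliminated because `A₀` is invertible and the nilpotent
part squares to zero (`PencilEquiv.decouple`). So `λ E₀ - A₀` carries all nonzero and infinite
eigenvalues, and `B` alone decides the Jordan structure at zero.

Both perturbations are built so that only `B` changes. The third block row of `UQX` vanishes, so a
perturbation supported in the third block row and column acts on `UQX` through its third row alone;
the third block column of `UQX` vanishes as well, so the second diagonal block remains square-zero.
Hence `B` is replaced by `L₃ Q₂ + s N Q₂ + t Ŷ Q₂`. Taking for `Nᴴ` minus the projection of `L₃ᴴ +
Ŷᴴ` onto `im Q₂` makes this zero at `s = t = 1`, which is semisimplicity; the size of the zero part,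
`n₂ + n₃`, never changes.

Semidefiniteness comes from a congruence. Solve `R₀ Z = Yᴴ` inside `im R₀`; the congruence that
subtracts `Zᴴ` times the rows 1, 2, 4 from the third row shifts the off-diagonal blocks of `R` by
exactly `-Y` and `-Yᴴ`, and changes the third diagonal block by a `K` that can be estimated.

To compare Kronecker forms, the canonical form supplied with the index hypothesis is split into zero
and nonzero blocks. Cancelling the nilpotent summands (`PencilEquiv.of_fromBlocks_nilpotent`) shows
that the nonzero blocks are a form of `λ E₀ - A₀`; the square-zero summand is put into Jordan form
by hand (`exists_kronecker_of_square_zero`). -/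

namespace PHPencil

open Matrix

/-! ### Invertibility of matrices with different row and column index types -/

section Invertible

variable {R l m n m' n' : Type*} [CommRing R] [Fintype l] [Fintype m] [Fintype n] [Fintype m']
  [Fintype n'] [DecidableEq l] [DecidableEq m] [DecidableEq n] [DecidableEq m'] [DecidableEq n']

theorem IsInvertible.one : IsInvertible (1 : Matrix m m R) :=
  ⟨1, by simp, by simp⟩

theorem IsInvertible.mul {M : Matrix l m R} {N : Matrix m n R} (hM : IsInvertible M)
    (hN : IsInvertible N) : IsInvertible (M * N) := by
  obtain ⟨M', h1, h2⟩ := hM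
  obtain ⟨N', h3, h4⟩ := hN
  refine ⟨N' * M', ?_, ?_⟩
  · rw [Matrix.mul_assoc, ← Matrix.mul_assoc N, h3, Matrix.one_mul, h1]
  · rw [Matrix.mul_assoc, ← Matrix.mul_assoc M', h2, Matrix.one_mul, h4]

theorem IsInvertible.fromBlocks_diagonal {M : Matrix m n R} {N : Matrix m' n' R}
    (hM : IsInvertible M) (hN : IsInvertible N) : IsInvertible (fromBlocks M 0 0 N) := by
  obtain ⟨M', h1, h2⟩ := hM
  obtain ⟨N', h3, h4⟩ := hN
  exact ⟨fromBlocks M' 0 0 N', by simp [fromBlocks_multiply, h1, h3, fromBlocks_one],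
    by simp [fromBlocks_multiply, h2, h4, fromBlocks_one]⟩

theorem IsInvertible.fromBlocks_lower {M : Matrix m n R} {N : Matrix m' n' R}
    (hM : IsInvertible M) (hN : IsInvertible N) (C : Matrix m' n R) :
    IsInvertible (fromBlocks M 0 C N) := by
  obtain ⟨M', h1, h2⟩ := hM
  obtain ⟨N', h3, h4⟩ := hN
  refine ⟨fromBlocks M' 0 (-(N' * C * M')) N', ?_, ?_⟩
  · simp [fromBlocks_multiply, h1, h3, ← fromBlocks_one, ← Matrix.mul_assoc]
  · simp [fromBlocks_multiply, h2, h4, ← fromBlocks_one, Matrix.mul_assoc]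

theorem IsInvertible.fromBlocks_upper {M : Matrix m n R} {N : Matrix m' n' R}
    (hM : IsInvertible M) (hN : IsInvertible N) (B : Matrix m n' R) :
    IsInvertible (fromBlocks M B 0 N) := by
  obtain ⟨M', h1, h2⟩ := hM
  obtain ⟨N', h3, h4⟩ := hN
  refine ⟨fromBlocks M' (-(M' * B * N')) 0 N', ?_, ?_⟩
  · simp [fromBlocks_multiply, h1, h3, ← fromBlocks_one, ← Matrix.mul_assoc]
  · simp [fromBlocks_multiply, h2, h4, ← fromBlocks_one, Matrix.mul_assoc]

theorem IsInvertible.submatrix_one (e : m ≃ n) :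
    IsInvertible ((1 : Matrix n n R).submatrix e id) :=
  ⟨(1 : Matrix n n R).submatrix id e,
    by ext i j; simp [Matrix.mul_apply, Matrix.one_apply, e.injective.eq_iff],
    by rw [submatrix_mul_equiv _ _ id e id]; simp⟩

theorem isInvertible_iff_isUnit {M : Matrix m m R} : IsInvertible M ↔ IsUnit M := by
  constructor
  · rintro ⟨N, h1, h2⟩
    exact ⟨⟨M, N, h1, h2⟩, rfl⟩
  · rintro ⟨u, rfl⟩
    exact ⟨↑u⁻¹, by simp, by simp⟩

theorem isInvertible_iff_det_ne_zero {K : Type*} [Field K] {M : Matrix m m K} :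
    IsInvertible M ↔ M.det ≠ 0 := by
  rw [isInvertible_iff_isUnit, isUnit_iff_isUnit_det, isUnit_iff_ne_zero]

theorem IsInvertible.card_eq [Nontrivial R] {M : Matrix m n R} (hM : IsInvertible M) :
    Fintype.card m = Fintype.card n := by
  obtain ⟨N, h1, h2⟩ := hM
  have e : (n → R) ≃ₗ[R] (m → R) := Matrix.toLin'OfInv h2 h1
  simpa using (LinearEquiv.finrank_eq e).symm

end Invertible

/-- Strict equivalence of pencils. -/
def PencilEquiv {m n m' n' : Type*} [Fintype m] [Fintype n] [Fintype m'] [Fintype n']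
    [DecidableEq m] [DecidableEq n] [DecidableEq m'] [DecidableEq n'] (E A : Matrix m n ℂ)
    (E' A' : Matrix m' n' ℂ) : Prop :=
  ∃ (S : Matrix m' m ℂ) (T : Matrix n n' ℂ),
    IsInvertible S ∧ IsInvertible T ∧ S * E * T = E' ∧ S * A * T = A'

/-! ### Calculus of strict equivalence -/

section PencilEquiv

variable {m n m' n' m'' n'' m₂ n₂ m₂' n₂' : Type*} [Fintype m] [Fintype n] [Fintype m']
  [Fintype n'] [Fintype m''] [Fintype n''] [Fintype m₂] [Fintype n₂] [Fintype m₂'] [Fintype n₂']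
  [DecidableEq m] [DecidableEq n] [DecidableEq m'] [DecidableEq n'] [DecidableEq m'']
  [DecidableEq n''] [DecidableEq m₂] [DecidableEq n₂] [DecidableEq m₂'] [DecidableEq n₂']

theorem PencilEquiv.symm {E A : Matrix m n ℂ} {E' A' : Matrix m' n' ℂ}
    (h : PencilEquiv E A E' A') : PencilEquiv E' A' E A := by
  obtain ⟨S, T, ⟨S', h1, h2⟩, ⟨T', h3, h4⟩, rfl, rfl⟩ := h
  have key (M : Matrix m n ℂ) : S' * (S * M * T) * T' = M := by
    simp only [Matrix.mul_assoc]
    rw [h3, Matrix.mul_one, ← Matrix.mul_assoc, h2, Matrix.one_mul]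
  exact ⟨S', T', ⟨S, h2, h1⟩, ⟨T, h4, h3⟩, key E, key A⟩

theorem PencilEquiv.trans {E A : Matrix m n ℂ} {E' A' : Matrix m' n' ℂ}
    {E'' A'' : Matrix m'' n'' ℂ} (h : PencilEquiv E A E' A') (h' : PencilEquiv E' A' E'' A'') :
    PencilEquiv E A E'' A'' := by
  obtain ⟨S, T, hS, hT, rfl, rfl⟩ := h
  obtain ⟨S', T', hS', hT', rfl, rfl⟩ := h'
  exact ⟨S' * S, T * T', hS'.mul hS, hT.mul hT', by simp only [Matrix.mul_assoc],
    by simp only [Matrix.mul_assoc]⟩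

theorem PencilEquiv.fromBlocks {E A : Matrix m n ℂ} {E' A' : Matrix m' n' ℂ}
    {F B : Matrix m₂ n₂ ℂ} {F' B' : Matrix m₂' n₂' ℂ} (h : PencilEquiv E A E' A')
    (h' : PencilEquiv F B F' B') :
    PencilEquiv (Matrix.fromBlocks E 0 0 F) (Matrix.fromBlocks A 0 0 B)
      (Matrix.fromBlocks E' 0 0 F') (Matrix.fromBlocks A' 0 0 B') := by
  obtain ⟨S, T, hS, hT, rfl, rfl⟩ := h
  obtain ⟨S', T', hS', hT', rfl, rfl⟩ := h'
  exact ⟨_, _, hS.fromBlocks_diagonal hS', hT.fromBlocks_diagonal hT',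
    by simp [fromBlocks_multiply], by simp [fromBlocks_multiply]⟩

theorem PencilEquiv.submatrix (E A : Matrix m n ℂ) (e : m' ≃ m) (f : n' ≃ n) :
    PencilEquiv E A (E.submatrix e f) (A.submatrix e f) := by
  have key (M : Matrix m n ℂ) :
      (1 : Matrix m m ℂ).submatrix e id * M * (1 : Matrix n n ℂ).submatrix id f =
        M.submatrix e f := by
    ext i j
    simp [Matrix.mul_apply, Matrix.one_apply]
  refine ⟨_, _, .submatrix_one e, ?_, key E, key A⟩
  refine ⟨(1 : Matrix n n ℂ).submatrix f id, ?_, ?_⟩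
  · rw [submatrix_mul_equiv _ _ id f id]; simp
  · ext i j
    simp [Matrix.mul_apply, Matrix.one_apply]

/-- The parameters are homogeneous so that the point `(0, -1)`, where the pencil reduces to `A`, is
included. -/
theorem PencilEquiv.isInvertible {E A : Matrix m n ℂ} {E' A' : Matrix m' n' ℂ}
    (h : PencilEquiv E A E' A') {μ ν : ℂ} (hM : IsInvertible (μ • E - ν • A)) :
    IsInvertible (μ • E' - ν • A') := by
  obtain ⟨S, T, hS, hT, rfl, rfl⟩ := h
  have : μ • (S * E * T) - ν • (S * A * T) = S * (μ • E - ν • A) * T := by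
    simp [Matrix.mul_sub, Matrix.sub_mul]
  rw [this]
  exact (hS.mul hM).mul hT

end PencilEquiv

/-! ### Families of Kronecker blocks -/

section Family

variable {m n m' n' : Type*} [Fintype m] [Fintype n] [Fintype m'] [Fintype n'] [DecidableEq m]
  [DecidableEq n] [DecidableEq m'] [DecidableEq n'] {ι κ : Type*} [Fintype ι] [Fintype κ]
  [DecidableEq ι] [DecidableEq κ]

/-- The block diagonal matrix of the `E`-coefficients of a family of blocks. -/
def diagE (b : ι → KBlock) : Matrix (Σ i, Fin (b i).rows) (Σ i, Fin (b i).cols) ℂ :=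
  blockDiagonal' fun i => (b i).coeffE

/-- The block diagonal matrix of the `A`-coefficients of a family of blocks. -/
def diagA (b : ι → KBlock) : Matrix (Σ i, Fin (b i).rows) (Σ i, Fin (b i).cols) ℂ :=
  blockDiagonal' fun i => (b i).coeffA

omit [Fintype ι] [Fintype κ] in
theorem blockDiagonal'_comp_equiv {p q : ι → Type*} [∀ i, Fintype (p i)] [∀ i, Fintype (q i)]
    (M : ∀ i, Matrix (p i) (q i) ℂ) (e : κ ≃ ι) :
    (blockDiagonal' fun k => M (e k)) =
      (blockDiagonal' M).submatrix (Equiv.sigmaCongrLeft e) (Equiv.sigmaCongrLeft e) := by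
  ext ⟨k, i⟩ ⟨k', j⟩
  change _ = blockDiagonal' M ⟨e k, i⟩ ⟨e k', j⟩
  rcases eq_or_ne k k' with rfl | hk
  · rw [blockDiagonal'_apply_eq, blockDiagonal'_apply_eq]
  · rw [blockDiagonal'_apply_ne _ _ _ hk, blockDiagonal'_apply_ne _ _ _ (e.injective.ne hk)]

theorem PencilEquiv.diag_comp_equiv (b : ι → KBlock) (e : κ ≃ ι) :
    PencilEquiv (diagE b) (diagA b) (diagE (b ∘ e)) (diagA (b ∘ e)) := by
  have hE := blockDiagonal'_comp_equiv (fun i => (b i).coeffE) e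
  have hA := blockDiagonal'_comp_equiv (fun i => (b i).coeffA) e
  change PencilEquiv _ _ (blockDiagonal' fun k => (b (e k)).coeffE)
    (blockDiagonal' fun k => (b (e k)).coeffA)
  rw [hE, hA]
  exact PencilEquiv.submatrix _ _ _ _

omit [Fintype ι] [Fintype κ] in
theorem blockDiagonal'_sum {p q : ι ⊕ κ → Type*} [∀ i, Fintype (p i)] [∀ i, Fintype (q i)]
    (M : ∀ i, Matrix (p i) (q i) ℂ) :
    blockDiagonal' M =
      (Matrix.fromBlocks (blockDiagonal' fun i => M (.inl i)) 0 0
        (blockDiagonal' fun i => M (.inr i))).submatrix (Equiv.sumSigmaDistrib _)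
          (Equiv.sumSigmaDistrib _) := by
  ext ⟨k | k, i⟩ ⟨k' | k', j⟩
  · simp only [submatrix_apply, Equiv.sumSigmaDistrib_apply, fromBlocks_apply₁₁]
    rcases eq_or_ne k k' with rfl | hk
    · rw [blockDiagonal'_apply_eq, blockDiagonal'_apply_eq]
    · rw [blockDiagonal'_apply_ne _ _ _ hk, blockDiagonal'_apply_ne _ _ _ (by simpa using hk)]
  · simp [blockDiagonal'_apply_ne]
  · simp [blockDiagonal'_apply_ne]
  · simp only [submatrix_apply, Equiv.sumSigmaDistrib_apply, fromBlocks_apply₂₂]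
    rcases eq_or_ne k k' with rfl | hk
    · rw [blockDiagonal'_apply_eq, blockDiagonal'_apply_eq]
    · rw [blockDiagonal'_apply_ne _ _ _ hk, blockDiagonal'_apply_ne _ _ _ (by simpa using hk)]

theorem PencilEquiv.diag_sumElim (b : ι → KBlock) (c : κ → KBlock) :
    PencilEquiv (Matrix.fromBlocks (diagE b) 0 0 (diagE c))
      (Matrix.fromBlocks (diagA b) 0 0 (diagA c)) (diagE (Sum.elim b c)) (diagA (Sum.elim b c)) := by
  unfold diagE diagA
  rw [blockDiagonal'_sum (fun i => (Sum.elim b c i).coeffE),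
    blockDiagonal'_sum (fun i => (Sum.elim b c i).coeffA)]
  exact PencilEquiv.submatrix _ _ _ _

/-- The members of a finite family of blocks, in some order. -/
noncomputable def blockList (b : ι → KBlock) : List KBlock :=
  List.ofFn (b ∘ (Fintype.equivFin ι).symm)

omit [DecidableEq ι] in
theorem mem_blockList {b : ι → KBlock} {x : KBlock} : x ∈ blockList b ↔ ∃ i, b i = x := by
  simp only [blockList, List.mem_ofFn, Function.comp_apply]
  exact ((Fintype.equivFin ι).symm.surjective.exists (p := fun i => b i = x)).symm

theorem IsKCF.of_family {E A : Matrix m n ℂ} {b : ι → KBlock} {K : List KBlock}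
    (h : PencilEquiv E A (diagE b) (diagA b)) (e : ι ≃ Fin K.length)
    (he : ∀ i, K.get (e i) = b i) : IsKCF E A K := by
  have h2 := h.trans (.diag_comp_equiv b e.symm)
  rw [show b ∘ e.symm = K.get from funext fun i => by simp [← he]] at h2
  exact h2

theorem IsKCF.append_blockList {E A : Matrix m n ℂ} {b : ι → KBlock} {c : κ → KBlock}
    (h : PencilEquiv E A (diagE (Sum.elim b c)) (diagA (Sum.elim b c))) :
    IsKCF E A (blockList b ++ blockList c) := by
  refine IsKCF.of_family h (((Fintype.equivFin ι).sumCongr (Fintype.equivFin κ)).trans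
    (finSumFinEquiv.trans (finCongr (by simp [blockList])))) fun i => ?_
  rw [List.get_eq_getElem]
  rcases i with i | i
  · rw [List.getElem_append_left (by
      simp only [blockList, List.length_ofFn]
      exact (Fintype.equivFin ι i).isLt)]
    simp only [blockList, List.getElem_ofFn, Function.comp_apply, Sum.elim_inl]
    exact congrArg b ((Equiv.symm_apply_eq _).mpr (Fin.ext rfl))
  · rw [List.getElem_append_right (by
      simp only [blockList, List.length_ofFn]
      exact Nat.le_add_right _ (Fintype.equivFin κ i).val)]
    simp only [blockList, List.getElem_ofFn, List.length_ofFn, Function.comp_apply, Sum.elim_inr]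
    refine congrArg c ((Equiv.symm_apply_eq _).mpr (Fin.ext ?_))
    exact Nat.add_sub_cancel_left _ (Fintype.equivFin κ i).val

end Family
end PHPencil

namespace PHPencil

open Matrix

/-! ### Cancelling nilpotent summands and decoupling triangular pencils -/

section Cancellation

variable {m n p q y z : Type*} [Fintype m] [Fintype n] [Fintype p] [Fintype q] [Fintype y]
  [Fintype z] [DecidableEq m] [DecidableEq n] [DecidableEq p] [DecidableEq q] [DecidableEq y]
  [DecidableEq z]

/-- Iterating the equation gives `s = M ^ k * s * W ^ k` for every `k`. -/
theorem eq_zero_of_eq_mul_nilpotent_left {M : Matrix z z ℂ} (hM : IsNilpotent M)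
    {W : Matrix n n ℂ} {s : Matrix z n ℂ} (h : s = M * s * W) : s = 0 := by
  obtain ⟨k, hk⟩ := hM
  have key (j : ℕ) : s = M ^ j * s * W ^ j := by
    induction j with
    | zero => simp
    | succ j ih =>
      calc s = M ^ j * (M * s * W) * W ^ j := by rw [← h, ← ih]
        _ = _ := by simp only [pow_succ M, pow_succ' W, Matrix.mul_assoc]
  rw [key k, hk]
  simp

theorem eq_zero_of_eq_mul_nilpotent_right {M : Matrix z z ℂ} (hM : IsNilpotent M)
    {W : Matrix n n ℂ} {s : Matrix n z ℂ} (h : s = W * s * M) : s = 0 := by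
  have hM' : IsNilpotent Mᵀ := by
    obtain ⟨k, hk⟩ := hM
    exact ⟨k, by rw [← transpose_pow, hk, transpose_zero]⟩
  have := eq_zero_of_eq_mul_nilpotent_left hM' (W := Wᵀ) (s := sᵀ) (by
    conv_lhs => rw [h]
    simp [Matrix.mul_assoc])
  simpa using congrArg transpose this

theorem IsInvertible.of_fromBlocks_diagonal {a : Matrix m n ℂ} {d : Matrix p q ℂ}
    (h : IsInvertible (fromBlocks a 0 0 d)) : IsInvertible a ∧ IsInvertible d := by
  obtain ⟨N, h1, h2⟩ := h
  rw [← fromBlocks_toBlocks N, fromBlocks_multiply, ← fromBlocks_one, fromBlocks_inj] at h1 h2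
  simp only [Matrix.zero_mul, Matrix.mul_zero, add_zero, zero_add] at h1 h2
  exact ⟨⟨_, h1.1, h2.1⟩, ⟨_, h1.2.2.2, h2.2.2.2⟩⟩

/-- A strict equivalence between pencils that are each split into a part without the eigenvalue
zero and a part with only the eigenvalue zero respects the splittings. -/
theorem PencilEquiv.of_fromBlocks_nilpotent {E A : Matrix m n ℂ} {E' A' : Matrix p q ℂ}
    {M : Matrix y y ℂ} {M' : Matrix z z ℂ} (hA : IsInvertible A) (hA' : IsInvertible A')
    (hM : IsNilpotent M) (hM' : IsNilpotent M')
    (h : PencilEquiv (Matrix.fromBlocks E 0 0 1) (Matrix.fromBlocks A 0 0 M)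
      (Matrix.fromBlocks E' 0 0 1) (Matrix.fromBlocks A' 0 0 M')) : PencilEquiv E A E' A' := by
  obtain ⟨S, T, hS, ⟨T', hT1, hT2⟩, hE, hB⟩ := h
  obtain ⟨B, hAB, hBA⟩ := hA
  obtain ⟨B', hAB', hBA'⟩ := hA'
  -- Moving `T` to the other side leaves relations that are linear in the blocks of `S` and of `T' =
  -- T⁻¹`.
  replace hE := congrArg (· * T') hE
  replace hB := congrArg (· * T') hB
  have hT' : IsInvertible T' := ⟨T, hT2, hT1⟩
  simp only [Matrix.mul_assoc, hT1, Matrix.mul_one] at hE hB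
  rw [← fromBlocks_toBlocks S, ← fromBlocks_toBlocks T'] at hE hB
  rw [← fromBlocks_toBlocks S] at hS
  rw [← fromBlocks_toBlocks T'] at hT'
  set a := S.toBlocks₁₁
  set b := S.toBlocks₁₂
  set c := S.toBlocks₂₁
  set d := S.toBlocks₂₂
  set t₁₁ := T'.toBlocks₁₁
  set t₁₂ := T'.toBlocks₁₂
  set t₂₁ := T'.toBlocks₂₁
  set t₂₂ := T'.toBlocks₂₂
  simp only [fromBlocks_multiply, fromBlocks_inj, Matrix.mul_zero, Matrix.zero_mul, add_zero,
    zero_add, Matrix.mul_one, Matrix.one_mul] at hE hB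
  obtain ⟨hE1, hE2, hE3, hE4⟩ := hE
  obtain ⟨hB1, hB2, hB3, hB4⟩ := hB
  -- The (2,1) blocks say `c E = t₂₁` and `c A = M' t₂₁`, so `c` is a fixed point of `c ↦ M' c (E
  -- A⁻¹)`. The (1,2) blocks treat `t₁₂` in the same way, with `M` on the right.
  have hc : c = 0 := by
    refine eq_zero_of_eq_mul_nilpotent_left hM' (W := E * B) ?_
    calc c = c * A * B := by rw [Matrix.mul_assoc, hAB, Matrix.mul_one]
      _ = M' * c * (E * B) := by rw [hB3, ← hE3]; simp only [Matrix.mul_assoc]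
  have ht : t₁₂ = 0 := by
    refine eq_zero_of_eq_mul_nilpotent_right hM (W := B' * E') ?_
    calc t₁₂ = B' * (A' * t₁₂) := by rw [← Matrix.mul_assoc, hBA', Matrix.one_mul]
      _ = B' * E' * t₁₂ * M := by rw [← hB2, hE2]; simp only [Matrix.mul_assoc]
  have hb : b = 0 := by rw [hE2, ht, Matrix.mul_zero]
  have ht' : t₂₁ = 0 := by rw [← hE3, hc, Matrix.zero_mul]
  rw [hb, hc] at hS
  rw [ht, ht'] at hT'
  obtain ⟨u, hu1, hu2⟩ := hT'.of_fromBlocks_diagonal.1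
  refine ⟨a, u, hS.of_fromBlocks_diagonal.1, ⟨_, hu2, hu1⟩, ?_, ?_⟩
  · rw [hE1, Matrix.mul_assoc, hu1, Matrix.mul_one]
  · rw [hB1, Matrix.mul_assoc, hu1, Matrix.mul_one]

/-- Decoupling of a block triangular pencil: if `A` is invertible and `M ^ 2 = 0`, the block below
the diagonal can be eliminated. -/
theorem PencilEquiv.decouple {E A : Matrix m m ℂ} {M : Matrix z z ℂ} (hA : IsInvertible A)
    (hM : M * M = 0) (F G : Matrix z m ℂ) :
    PencilEquiv (Matrix.fromBlocks E 0 F 1) (Matrix.fromBlocks A 0 G M)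
      (Matrix.fromBlocks E 0 0 1) (Matrix.fromBlocks A 0 0 M) := by
  obtain ⟨B, hAB, hBA⟩ := hA
  -- Unipotent factors with lower blocks `x`, `y` must satisfy `x E + F + y = 0` and `x A + G + M y
  -- = 0`. Eliminating `x` leaves `y = C + M y B E`, whose Neumann series stops after two terms
  -- since `M * M = 0`.
  obtain ⟨C, hC⟩ : ∃ C, C = G * B * E - F := ⟨_, rfl⟩
  obtain ⟨y, hy⟩ : ∃ y, y = C + M * C * (B * E) := ⟨_, rfl⟩
  obtain ⟨x, hx⟩ : ∃ x, x = -((G + M * y) * B) := ⟨_, rfl⟩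
  have hMy : M * y = M * C := by
    rw [hy, Matrix.mul_add, Matrix.mul_assoc M C, ← Matrix.mul_assoc M M, hM, Matrix.zero_mul,
      add_zero]
  refine ⟨Matrix.fromBlocks 1 0 x 1, Matrix.fromBlocks 1 0 y 1, .fromBlocks_lower .one .one _,
    .fromBlocks_lower .one .one _, ?_, ?_⟩
  · simp only [fromBlocks_multiply, Matrix.mul_zero, Matrix.zero_mul, add_zero, zero_add,
      Matrix.mul_one, Matrix.one_mul]
    congr 1
    rw [hx, hMy, hy, hC]
    simp only [Matrix.add_mul, Matrix.neg_mul, Matrix.mul_assoc]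
    abel
  · simp only [fromBlocks_multiply, Matrix.mul_zero, Matrix.zero_mul, add_zero, zero_add,
      Matrix.mul_one, Matrix.one_mul]
    congr 1
    rw [hx, Matrix.neg_mul, Matrix.mul_assoc, hBA, Matrix.mul_one]
    abel

end Cancellation

/-! ### Invertibility of block diagonal matrices -/

section BlockDiagonal

variable {ι : Type*} [Fintype ι] [DecidableEq ι] {p q : ι → Type*} [∀ i, Fintype (p i)]
  [∀ i, Fintype (q i)] [∀ i, DecidableEq (p i)] [∀ i, DecidableEq (q i)]

theorem isInvertible_blockDiagonal' {M : ∀ i, Matrix (p i) (q i) ℂ}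
    (h : ∀ i, IsInvertible (M i)) : IsInvertible (blockDiagonal' M) := by
  choose N h1 h2 using h
  exact ⟨blockDiagonal' N, by
    rw [← blockDiagonal'_mul]
    simp only [h1]
    exact blockDiagonal'_one, by
    rw [← blockDiagonal'_mul]
    simp only [h2]
    exact blockDiagonal'_one⟩

/-- The blocks may be rectangular, so determinants are unavailable; the `k`-th diagonal block of the
inverse inverts `M k`. -/
theorem IsInvertible.of_blockDiagonal' {M : ∀ i, Matrix (p i) (q i) ℂ}
    (h : IsInvertible (blockDiagonal' M)) (k : ι) : IsInvertible (M k) := by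
  obtain ⟨N, h1, h2⟩ := h
  refine ⟨N.submatrix (Sigma.mk k) (Sigma.mk k), ?_, ?_⟩
  · ext i j
    have := congrFun (congrFun h1 ⟨k, i⟩) ⟨k, j⟩
    rw [Matrix.mul_apply, Fintype.sum_sigma, Finset.sum_eq_single k] at this
    · simpa [Matrix.mul_apply, blockDiagonal'_apply_eq, Matrix.one_apply] using this
    · intro k' _ hk
      simp [blockDiagonal'_apply_ne _ _ _ hk.symm]
    · simp
  · ext i j
    have := congrFun (congrFun h2 ⟨k, i⟩) ⟨k, j⟩
    rw [Matrix.mul_apply, Fintype.sum_sigma, Finset.sum_eq_single k] at this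
    · simpa [Matrix.mul_apply, blockDiagonal'_apply_eq, Matrix.one_apply] using this
    · intro k' _ hk
      simp [blockDiagonal'_apply_ne _ _ _ hk]
    · simp

end BlockDiagonal

/-! ### Kronecker blocks of a regular pencil -/

section Blocks

variable {ι : Type*} [Fintype ι] [DecidableEq ι]

/-- This excludes the blocks of the minimal indices from the canonical form of a regular pencil. -/
theorem rows_eq_cols_of_isInvertible {b : ι → KBlock} {μ : ℂ}
    (h : IsInvertible (μ • diagE b - diagA b)) (i : ι) : (b i).rows = (b i).cols := by
  rw [diagE, diagA, ← blockDiagonal'_smul, ← blockDiagonal'_sub] at h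
  simpa using (h.of_blockDiagonal' i).card_eq

theorem KBlock.isInvertible_coeffA {b : KBlock} (hb : b.rows = b.cols)
    (h0 : ∀ ρ, b ≠ .jordan 0 ρ) : IsInvertible b.coeffA := by
  cases b with
  | right ε => simp [KBlock.rows, KBlock.cols] at hb
  | left η => simp [KBlock.rows, KBlock.cols] at hb
  | jordan μ ρ =>
    have hμ : μ ≠ 0 := fun h => h0 ρ (by rw [h])
    let A : Matrix (Fin ρ) (Fin ρ) ℂ := Matrix.of fun i j =>
      if i.val = j.val then μ else if j.val = i.val + 1 then 1 else 0
    change IsInvertible A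
    have hA : A.BlockTriangular id := by
      intro i j hij
      have hij' : (j : ℕ) < i := hij
      simp only [A, of_apply]
      rw [if_neg (by omega), if_neg (by omega)]
    rw [isInvertible_iff_det_ne_zero, det_of_isUpperTriangular hA]
    simp [A, hμ]
  | nilp σ =>
    have : (KBlock.nilp σ).coeffA = (1 : Matrix (Fin σ) (Fin σ) ℂ) := by
      ext (i : Fin σ) (j : Fin σ)
      change (if i.val = j.val then (1 : ℂ) else 0) = _
      simp [Matrix.one_apply, Fin.ext_iff]
    rw [this]
    exact .one

omit [Fintype ι] in
theorem diagE_jordan (μ : ℂ) (ρ : ι → ℕ+) :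
    diagE (fun i => .jordan μ (ρ i)) = (1 : Matrix (Σ i, Fin (ρ i)) (Σ i, Fin (ρ i)) ℂ) := by
  have (i : ι) : (KBlock.jordan μ (ρ i)).coeffE = (1 : Matrix (Fin (ρ i)) (Fin (ρ i)) ℂ) := by
    ext (j : Fin (ρ i)) (k : Fin (ρ i))
    change (if j.val = k.val then (1 : ℂ) else 0) = _
    simp [Matrix.one_apply, Fin.ext_iff]
  simp only [diagE, this]
  exact blockDiagonal'_one

/-- A nonzero entry of `M ^ k` needs a path along which `f` grows by at least `k`, which is
impossible once `k` exceeds the maximum of `f`. -/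
theorem isNilpotent_of_strictly_increasing {m : Type*} [Fintype m] [DecidableEq m]
    {M : Matrix m m ℂ} (f : m → ℕ) (h : ∀ x y, M x y ≠ 0 → f x < f y) : IsNilpotent M := by
  have key (k : ℕ) : ∀ x y, (M ^ k) x y ≠ 0 → f x + k ≤ f y := by
    induction k with
    | zero =>
      intro x y hxy
      rw [pow_zero, Matrix.one_apply] at hxy
      have : x = y := by by_contra hne; simp [hne] at hxy
      simp [this]
    | succ k ih =>
      intro x y hxy
      rw [pow_succ, Matrix.mul_apply] at hxy
      obtain ⟨w, -, hw⟩ := Finset.exists_ne_zero_of_sum_ne_zero hxy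
      have h1 := ih x w (left_ne_zero_of_mul hw)
      have h2 := h w y (right_ne_zero_of_mul hw)
      omega
  refine ⟨Finset.univ.sup f + 1, ?_⟩
  ext x y
  by_contra hne
  have h1 := key _ x y hne
  have h2 : f y ≤ Finset.univ.sup f := Finset.le_sup (Finset.mem_univ y)
  omega

/-- The `A`-coefficient of a family of Jordan blocks for the eigenvalue zero. -/
def nilpotentDiag (ρ : ι → ℕ+) : Matrix (Σ i, Fin (ρ i)) (Σ i, Fin (ρ i)) ℂ :=
  blockDiagonal' fun _ => of fun j k => if k.val = j.val + 1 then 1 else 0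

omit [Fintype ι] in
theorem diagA_jordan_zero (ρ : ι → ℕ+) :
    diagA (fun i => .jordan 0 (ρ i)) = nilpotentDiag ρ := by
  have (i : ι) : (KBlock.jordan 0 (ρ i)).coeffA =
      (of fun j k : Fin (ρ i) => if k.val = j.val + 1 then (1 : ℂ) else 0) := by
    ext (j : Fin (ρ i)) (k : Fin (ρ i))
    change (if j.val = k.val then (0 : ℂ) else if k.val = j.val + 1 then 1 else 0) =
      if k.val = j.val + 1 then 1 else 0
    split_ifs <;> first | rfl | omega
  simp only [diagA, this]
  rfl

theorem isNilpotent_nilpotentDiag (ρ : ι → ℕ+) : IsNilpotent (nilpotentDiag ρ) := by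
  refine isNilpotent_of_strictly_increasing (fun x => x.2.val) ?_
  rintro ⟨k, i⟩ ⟨k', j⟩ h
  rcases eq_or_ne k k' with rfl | hk
  · rw [nilpotentDiag, blockDiagonal'_apply_eq, of_apply] at h
    have : j.val = i.val + 1 := by by_contra hne; simp [hne] at h
    exact Nat.lt_of_succ_le this.ge
  · exact absurd (blockDiagonal'_apply_ne _ _ _ hk) h

/-- The zero and the nonzero Kronecker blocks of a regular pencil given by a Kronecker canonical
form, as two families. -/
theorem IsKCF.exists_splitting {n : Type*} [Fintype n] [DecidableEq n] {E A : Matrix n n ℂ}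
    {K : List KBlock} (hK : IsKCF E A K) (hreg : IsRegular E A) :
    ∃ (r s : ℕ) (b : Fin r → KBlock) (ρ : Fin s → ℕ+), (∀ i ρ, b i ≠ .jordan 0 ρ) ∧
      IsInvertible (diagA b) ∧
      PencilEquiv E A (fromBlocks (diagE b) 0 0 (1 : Matrix (Σ i, Fin (ρ i)) (Σ i, Fin (ρ i)) ℂ))
        (fromBlocks (diagA b) 0 0 (nilpotentDiag ρ)) := by
  classical
  let P : Fin K.length → Prop := fun i => ∃ ρ, K.get i = .jordan 0 ρ
  let eN := Fintype.equivFin {i // ¬ P i}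
  let eP := Fintype.equivFin {i // P i}
  let b : Fin (Fintype.card {i // ¬ P i}) → KBlock := fun i => K.get (eN.symm i)
  choose ρ hρ using fun i => (eP.symm i).2
  let e : Fin (Fintype.card {i // ¬ P i}) ⊕ Fin (Fintype.card {i // P i}) ≃ Fin K.length :=
    (eN.symm.sumCongr eP.symm).trans ((Equiv.sumComm _ _).trans (Equiv.sumCompl P))
  have h1 : PencilEquiv E A (diagE K.get) (diagA K.get) := hK
  have h2 := h1.trans (.diag_comp_equiv K.get e)
  have he : K.get ∘ e = Sum.elim b (fun i => .jordan 0 (ρ i)) := by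
    ext1 i
    rcases i with i | i
    · simp [e, b]
    · simpa [e] using hρ i
  rw [he] at h2
  have h3 := h2.trans (PencilEquiv.diag_sumElim _ _).symm
  have hb (i) (ρ) : b i ≠ .jordan 0 ρ := fun h => (eN.symm i).2 ⟨ρ, h⟩
  rw [diagE_jordan, diagA_jordan_zero] at h3
  refine ⟨_, _, b, ρ, hb, ?_, h3⟩
  -- At a regular point the block diagonal matrix is invertible, so every block is square; among
  -- square blocks only Jordan blocks for the eigenvalue zero have a singular `A`-coefficient.
  obtain ⟨μ, hμ⟩ := hreg
  have h4 : IsInvertible (μ • E - (1 : ℂ) • A) := by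
    rwa [one_smul, isInvertible_iff_det_ne_zero]
  have h5 := h2.isInvertible h4
  rw [one_smul] at h5
  exact isInvertible_blockDiagonal' fun i =>
    KBlock.isInvertible_coeffA (rows_eq_cols_of_isInvertible h5 (.inl i)) (hb i)

end Blocks

end PHPencil

namespace PHPencil

open Matrix

/-! ### Jordan form of a square-zero matrix -/

section SquareZero

variable {p q : Type*} [Fintype p] [Fintype q] [DecidableEq p] [DecidableEq q]

/-- Rank normal form of a matrix. -/
theorem exists_rank_normal_form (B : Matrix p q ℂ) :
    ∃ (r a b : ℕ) (S : Matrix (Fin r ⊕ Fin a) p ℂ) (T : Matrix q (Fin r ⊕ Fin b) ℂ),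
      IsInvertible S ∧ IsInvertible T ∧ S * B * T = fromBlocks 1 0 0 0 := by
  let f : (q → ℂ) →ₗ[ℂ] (p → ℂ) := Matrix.toLin' B
  obtain ⟨C, hC⟩ := (LinearMap.ker f).exists_isCompl
  obtain ⟨D, hD⟩ := (LinearMap.range f).exists_isCompl
  let bC := Module.finBasis ℂ C
  let bK := Module.finBasis ℂ (LinearMap.ker f)
  let bD := Module.finBasis ℂ D
  -- The basis of the range is the image of the basis of a complement of the kernel, which produces
  -- the identity block.
  let bR := bC.map (f.kerComplementEquivRange hC.symm)
  let bq := (bC.prod bK).map (Submodule.prodEquivOfIsCompl _ _ hC.symm)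
  let bp := (bR.prod bD).map (Submodule.prodEquivOfIsCompl _ _ hD)
  refine ⟨_, _, _, bp.toMatrix (Pi.basisFun ℂ p), (Pi.basisFun ℂ q).toMatrix bq,
    ⟨_, Module.Basis.toMatrix_mul_toMatrix_flip _ _, Module.Basis.toMatrix_mul_toMatrix_flip _ _⟩,
    ⟨_, Module.Basis.toMatrix_mul_toMatrix_flip _ _, Module.Basis.toMatrix_mul_toMatrix_flip _ _⟩,
    ?_⟩
  have hB : B = LinearMap.toMatrix (Pi.basisFun ℂ q) (Pi.basisFun ℂ p) f := by
    ext i j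
    simp [LinearMap.toMatrix_apply, f]
  conv_lhs => rw [hB]
  rw [basis_toMatrix_mul_linearMap_toMatrix_mul_basis_toMatrix]
  have h1 (i) : f (bq (.inl i)) = bp (.inl i) := by
    simp [bq, bp, bR]
  have h2 (i) : f (bq (.inr i)) = 0 := by
    simp [bq]
  ext i (j | j)
  · rw [LinearMap.toMatrix_apply, h1, Module.Basis.repr_self]
    rcases i with i | i <;> simp [Matrix.one_apply, Finsupp.single_apply, eq_comm]
  · rw [LinearMap.toMatrix_apply, h2]
    rcases i with i | i <;> simp

/-- The sizes of `r` Jordan blocks of size two and of Jordan blocks of size one. -/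
def sizesTwoOne (r a b : ℕ) : Fin r ⊕ (Fin a ⊕ Fin b) → ℕ+ := Sum.elim (fun _ => 2) (fun _ => 1)

/-- The numbering of the basis vectors in the Jordan chains of lengths two and one. -/
def chainIndex (r a b : ℕ) :
    (Fin r ⊕ Fin b) ⊕ (Fin r ⊕ Fin a) → Σ i, Fin (sizesTwoOne r a b i)
  | .inr (.inl i) => ⟨.inl i, ⟨0, PNat.pos _⟩⟩
  | .inl (.inl i) => ⟨.inl i, ⟨1, Nat.one_lt_two⟩⟩
  | .inr (.inr j) => ⟨.inr (.inl j), ⟨0, PNat.pos _⟩⟩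
  | .inl (.inr j) => ⟨.inr (.inr j), ⟨0, PNat.pos _⟩⟩

theorem chainIndex_bijective (r a b : ℕ) : Function.Bijective (chainIndex r a b) := by
  constructor
  · intro x y h
    have h1 := congrArg Sigma.fst h
    have h2 := congrArg (fun w => w.2.val) h
    rcases x with (i | i) | (i | i) <;> rcases y with (j | j) | (j | j) <;>
      simp_all [chainIndex]
  · rintro ⟨i | i | i, k, hk⟩
    · replace hk : k < 2 := hk
      interval_cases k
      exacts [⟨.inr (.inl i), rfl⟩, ⟨.inl (.inl i), rfl⟩]
    · obtain rfl : k = 0 := Nat.lt_one_iff.mp hk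
      exact ⟨.inr (.inr i), rfl⟩
    · obtain rfl : k = 0 := Nat.lt_one_iff.mp hk
      exact ⟨.inl (.inr i), rfl⟩

theorem nilpotentDiag_apply {ι : Type*} [DecidableEq ι] (ρ : ι → ℕ+) (x y : Σ i, Fin (ρ i)) :
    nilpotentDiag ρ x y = if x.1 = y.1 ∧ y.2.val = x.2.val + 1 then 1 else 0 := by
  obtain ⟨i, k⟩ := x
  obtain ⟨j, l⟩ := y
  rcases eq_or_ne i j with rfl | hij
  · rw [nilpotentDiag, blockDiagonal'_apply_eq]
    simp
  · rw [nilpotentDiag, blockDiagonal'_apply_ne _ _ _ hij]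
    simp [hij]

theorem nilpotentDiag_submatrix_chainIndex (r a b : ℕ) :
    (nilpotentDiag (sizesTwoOne r a b)).submatrix (chainIndex r a b) (chainIndex r a b) =
      fromBlocks 0 0 (fromBlocks 1 0 0 0) 0 := by
  ext ((i | i) | (i | i)) ((j | j) | (j | j)) <;>
    simp [nilpotentDiag_apply, chainIndex, Matrix.one_apply]

/-- Kronecker structure of `λ I - N` with `N ^ 2 = 0`, where `N` is given in block form. -/
theorem exists_kronecker_of_square_zero (B : Matrix p q ℂ) :
    ∃ r a b : ℕ, PencilEquiv (1 : Matrix (q ⊕ p) (q ⊕ p) ℂ) (fromBlocks 0 0 B 0) 1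
      (nilpotentDiag (sizesTwoOne r a b)) ∧ (B = 0 → r = 0) := by
  obtain ⟨r, a, b, S, T, hS, hT, hB⟩ := exists_rank_normal_form B
  refine ⟨r, a, b, ?_, fun h0 => ?_⟩
  · obtain ⟨S', hS1, hS2⟩ := hS
    obtain ⟨T', hT1, hT2⟩ := hT
    let e := Equiv.ofBijective _ (chainIndex_bijective r a b)
    have h1 : PencilEquiv (1 : Matrix (q ⊕ p) (q ⊕ p) ℂ) (fromBlocks 0 0 B 0) 1
        (fromBlocks (0 : Matrix (Fin r ⊕ Fin b) (Fin r ⊕ Fin b) ℂ) 0 (fromBlocks (1 : Matrix (Fin r) (Fin r) ℂ) 0 0 0)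
          (0 : Matrix (Fin r ⊕ Fin a) (Fin r ⊕ Fin a) ℂ)) := by
      -- A similarity by `diag(T, S⁻¹)`: it keeps the identity and turns `B` into its rank normal
      -- form, in which each unit entry links two basis vectors into a chain of length two.
      refine ⟨fromBlocks T' 0 0 S, fromBlocks T 0 0 S',
        .fromBlocks_diagonal ⟨T, hT2, hT1⟩ ⟨S', hS1, hS2⟩,
        .fromBlocks_diagonal ⟨T', hT1, hT2⟩ ⟨S, hS2, hS1⟩, ?_, ?_⟩
      · simp [fromBlocks_multiply, hS1, hT2]
      · simp [fromBlocks_multiply, hB]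
    have h2 := PencilEquiv.submatrix 1 (nilpotentDiag (sizesTwoOne r a b)) e e
    rw [submatrix_one_equiv] at h2
    have h3 : (nilpotentDiag (sizesTwoOne r a b)).submatrix e e = _ :=
      nilpotentDiag_submatrix_chainIndex r a b
    rw [h3] at h2
    exact h1.trans h2.symm
  · by_contra hr
    have := congrFun (congrFun hB (.inl ⟨0, Nat.pos_of_ne_zero hr⟩)) (.inl ⟨0, Nat.pos_of_ne_zero hr⟩)
    simp [h0] at this

end SquareZero

end PHPencil

namespace PHPencil

open Matrix Filter Topology

/-! ### Spectral structure of decoupled pencils -/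

section Decoupled

variable {n m p q z : Type*} [Fintype n] [Fintype m] [Fintype p] [Fintype q] [Fintype z]
  [DecidableEq n] [DecidableEq m] [DecidableEq p] [DecidableEq q] [DecidableEq z]

theorem PencilEquiv.isInvertible_right_iff {m n m' n' : Type*} [Fintype m] [Fintype n] [Fintype m']
    [Fintype n'] [DecidableEq m] [DecidableEq n] [DecidableEq m'] [DecidableEq n']
    {E A : Matrix m n ℂ} {E' A' : Matrix m' n' ℂ} (h : PencilEquiv E A E' A') :
    IsInvertible A ↔ IsInvertible A' := by
  constructor
  · intro hA
    simpa using h.isInvertible (μ := 0) (ν := -1) (by simpa using hA)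
  · intro hA
    simpa using h.symm.isInvertible (μ := 0) (ν := -1) (by simpa using hA)

/-- Multiplying the second block row by `diag(D⁻¹, 1)` normalizes the `E`-coefficient and leaves `[0
0; B 0]` untouched, because its first row is zero. Decoupling then applies. -/
theorem PencilEquiv.block_triangular {E₀ A₀ : Matrix m m ℂ} (hA : IsInvertible A₀)
    {D : Matrix q q ℂ} (hD : IsInvertible D) (F G : Matrix (q ⊕ p) m ℂ) (B : Matrix p q ℂ) :
    PencilEquiv (Matrix.fromBlocks E₀ 0 F (Matrix.fromBlocks D 0 0 (1 : Matrix p p ℂ)))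
      (Matrix.fromBlocks A₀ 0 G (Matrix.fromBlocks 0 0 B 0)) (Matrix.fromBlocks E₀ 0 0 (1 : Matrix (q ⊕ p) (q ⊕ p) ℂ))
      (Matrix.fromBlocks A₀ 0 0 (Matrix.fromBlocks 0 0 B 0)) := by
  obtain ⟨D', h1, h2⟩ := hD
  let W : Matrix (q ⊕ p) (q ⊕ p) ℂ := Matrix.fromBlocks D' 0 0 1
  have hW : IsInvertible W := IsInvertible.fromBlocks_diagonal ⟨D, h2, h1⟩ .one
  have h : PencilEquiv (Matrix.fromBlocks E₀ 0 F (Matrix.fromBlocks D 0 0 (1 : Matrix p p ℂ)))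
      (Matrix.fromBlocks A₀ 0 G (Matrix.fromBlocks 0 0 B 0)) (Matrix.fromBlocks E₀ 0 (W * F) 1)
      (Matrix.fromBlocks A₀ 0 (W * G) (Matrix.fromBlocks 0 0 B 0)) :=
    ⟨Matrix.fromBlocks 1 0 0 W, 1, .fromBlocks_diagonal .one hW, .one,
      by simp [W, fromBlocks_multiply, h2], by simp [W, fromBlocks_multiply]⟩
  exact h.trans (.decouple hA (by simp [fromBlocks_multiply]) _ _)

/-- The determinant is continuous and nonzero at `μ = 0`. A nonzero `μ` is needed because `μ I - M`
is singular at zero for nilpotent `M` of positive size. -/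
theorem exists_ne_zero_isInvertible (E : Matrix m m ℂ) {A : Matrix m m ℂ} (hA : IsInvertible A) :
    ∃ μ : ℂ, μ ≠ 0 ∧ IsInvertible (μ • E - A) := by
  have hc : Continuous fun μ : ℂ => (μ • E - A).det := by fun_prop
  have h0 : ((0 : ℂ) • E - A).det ≠ 0 := by
    rw [zero_smul, zero_sub, det_neg]
    exact mul_ne_zero (pow_ne_zero _ (by norm_num)) (isInvertible_iff_det_ne_zero.mp hA)
  have h1 : ∀ᶠ μ in 𝓝[≠] (0 : ℂ), (μ • E - A).det ≠ 0 :=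
    (hc.continuousAt.eventually_ne h0).filter_mono nhdsWithin_le_nhds
  obtain ⟨μ, h2, h3⟩ := (h1.and self_mem_nhdsWithin).exists
  exact ⟨μ, h3, isInvertible_iff_det_ne_zero.mpr h2⟩

variable {E A : Matrix n n ℂ} {E₀ A₀ : Matrix m m ℂ} {M : Matrix z z ℂ}

theorem PencilEquiv.isRegular (hA : IsInvertible A₀) (hM : IsNilpotent M)
    (h : PencilEquiv E A (Matrix.fromBlocks E₀ 0 0 1) (Matrix.fromBlocks A₀ 0 0 M)) :
    IsRegular E A := by
  obtain ⟨μ, hμ, h1⟩ := exists_ne_zero_isInvertible E₀ hA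
  refine ⟨μ, ?_⟩
  rw [← isInvertible_iff_det_ne_zero]
  rw [← one_smul ℂ A]
  refine h.symm.isInvertible ?_
  rw [one_smul, Matrix.fromBlocks_smul, sub_eq_add_neg, Matrix.fromBlocks_neg,
    Matrix.fromBlocks_add]
  simp only [smul_zero, neg_zero, add_zero, ← sub_eq_add_neg]
  refine h1.fromBlocks_diagonal (isInvertible_iff_isUnit.mpr ?_)
  have hu : IsUnit (μ • (1 : Matrix z z ℂ)) :=
    ⟨⟨μ • 1, μ⁻¹ • 1, by simp [hμ], by simp [hμ]⟩, rfl⟩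
  rw [sub_eq_add_neg]
  exact hM.neg.isUnit_add_left_of_commute hu ((Commute.one_right _).smul_right _)

theorem isEigenvalue_zero_iff_of_isRegular (hreg : IsRegular E A) :
    IsEigenvalue E A 0 ↔ ¬ IsInvertible A := by
  have hrank (N : Matrix n n ℂ) : N.rank = Fintype.card n ↔ IsUnit N := by
    refine ⟨fun h => ?_, rank_of_isUnit N⟩
    rw [← mulVec_surjective_iff_isUnit]
    have : LinearMap.range N.mulVecLin = ⊤ :=
      Submodule.eq_top_of_finrank_eq (by simpa [Matrix.rank] using h)
    exact LinearMap.range_eq_top.mp this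
  have h0 : IsInvertible A ↔ ((0 : ℂ) • E - A).rank = Fintype.card n := by
    rw [hrank, isInvertible_iff_isUnit, zero_smul, zero_sub, IsUnit.neg_iff]
  unfold IsEigenvalue
  rw [h0]
  constructor
  · rintro ⟨α, hα⟩ h
    exact absurd (rank_le_card_width (α • E - A)) (by omega)
  · intro h
    obtain ⟨μ, hμ⟩ := hreg
    refine ⟨μ, ?_⟩
    rw [(hrank (μ • E - A)).mpr ((isUnit_iff_isUnit_det _).mpr hμ.isUnit)]
    exact lt_of_le_of_ne (rank_le_card_width _) h

/-- Zero is an eigenvalue exactly when the nilpotent summand has positive size. The criterion does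
not depend on `M`, so it carries over to the perturbed pencil. -/
theorem PencilEquiv.isEigenvalue_zero_iff (hA : IsInvertible A₀) (hM : IsNilpotent M)
    (h : PencilEquiv E A (Matrix.fromBlocks E₀ 0 0 1) (Matrix.fromBlocks A₀ 0 0 M)) :
    IsEigenvalue E A 0 ↔ Nonempty z := by
  rw [isEigenvalue_zero_iff_of_isRegular (h.isRegular hA hM), h.isInvertible_right_iff,
    ← not_isEmpty_iff, not_iff_not]
  constructor
  · intro h1
    have h2 := isInvertible_iff_isUnit.mp h1.of_fromBlocks_diagonal.2
    by_contra hz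
    rw [not_isEmpty_iff] at hz
    obtain ⟨k, hk⟩ := hM
    exact not_isUnit_zero (hk ▸ h2.pow k)
  · intro hz
    exact hA.fromBlocks_diagonal ⟨0, Subsingleton.elim _ _, Subsingleton.elim _ _⟩

theorem PencilEquiv.isKCF {E' A' : Matrix n n ℂ} {r s a b : ℕ} {c : Fin s → KBlock}
    (h : PencilEquiv E' A' (Matrix.fromBlocks (diagE c) 0 0 1)
      (Matrix.fromBlocks (diagA c) 0 0 (nilpotentDiag (sizesTwoOne r a b)))) :
    IsKCF E' A' (blockList c ++ blockList fun i => .jordan 0 (sizesTwoOne r a b i)) := by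
  refine IsKCF.append_blockList (h.trans ?_)
  have := PencilEquiv.diag_sumElim c fun i => .jordan 0 (sizesTwoOne r a b i)
  rw [diagE_jordan, diagA_jordan_zero] at this
  exact this

/-- Regular pencils that differ only in a square-zero nilpotent part. -/
theorem kroneckerStructure_of_decoupled {E' A' : Matrix n n ℂ} {B B' : Matrix p q ℂ}
    (hA : IsInvertible A₀) {K : List KBlock} (hK : IsKCF E A K)
    (h : PencilEquiv E A (Matrix.fromBlocks E₀ 0 0 (1 : Matrix (q ⊕ p) (q ⊕ p) ℂ))
      (Matrix.fromBlocks A₀ 0 0 (Matrix.fromBlocks 0 0 B 0)))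
    (h' : PencilEquiv E' A' (Matrix.fromBlocks E₀ 0 0 (1 : Matrix (q ⊕ p) (q ⊕ p) ℂ))
      (Matrix.fromBlocks A₀ 0 0 (Matrix.fromBlocks 0 0 B' 0))) :
    SameNonzeroKroneckerStructure E A E' A' ∧
      (B' = 0 → ∃ K', IsKCF E' A' K' ∧ ∀ ρ, KBlock.jordan 0 ρ ∈ K' → ρ = 1) := by
  have hnil (B : Matrix p q ℂ) :
      IsNilpotent (Matrix.fromBlocks 0 0 B 0 : Matrix (q ⊕ p) (q ⊕ p) ℂ) :=
    ⟨2, by simp [pow_two, fromBlocks_multiply]⟩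
  obtain ⟨k, s, c, ρ, hc, hcA, hsplit⟩ := hK.exists_splitting (h.isRegular hA (hnil B))
  -- Cancelling the two nilpotent parts yields a common list of nonzero blocks for both pencils.
  have h0 : PencilEquiv E₀ A₀ (diagE c) (diagA c) :=
    .of_fromBlocks_nilpotent hA hcA (hnil B) (isNilpotent_nilpotentDiag ρ) (h.symm.trans hsplit)
  obtain ⟨r, a, b, hB, -⟩ := exists_kronecker_of_square_zero B
  obtain ⟨r', a', b', hB', hr'⟩ := exists_kronecker_of_square_zero B'
  have h1 := (h.trans (h0.fromBlocks hB)).isKCF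
  have h1' := (h'.trans (h0.fromBlocks hB')).isKCF
  refine ⟨⟨_, _, _, ?_, ?_, ?_, h1, h1'⟩, fun hB0 => ⟨_, h1', fun ρ hρ => ?_⟩⟩
  · intro x hx ρ
    obtain ⟨i, rfl⟩ := mem_blockList.mp hx
    exact hc i ρ
  · intro x hx
    obtain ⟨i, rfl⟩ := mem_blockList.mp hx
    exact ⟨_, rfl⟩
  · intro x hx
    obtain ⟨i, rfl⟩ := mem_blockList.mp hx
    exact ⟨_, rfl⟩
  · rcases List.mem_append.mp hρ with hρ | hρ
    · obtain ⟨i, hi⟩ := mem_blockList.mp hρ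
      exact absurd hi (hc i ρ)
    · obtain ⟨i, hi⟩ := mem_blockList.mp hρ
      -- The rank of `B'` counts the blocks of size two, so none are left.
      obtain rfl := hr' hB0
      rcases i with i | i
      · exact i.elim0
      · simp only [KBlock.jordan.injEq, true_and] at hi
        exact hi.symm

end Decoupled

end PHPencil

namespace PHPencil

open Matrix

/-! ### Passage from `𝕜` to `ℂ` -/

section Complexification

variable {𝕜 : Type*} [RCLike 𝕜]

/-- The embedding of `𝕜 = ℝ` or `ℂ` into `ℂ`. -/
def toComplexHom (𝕜 : Type*) [RCLike 𝕜] : 𝕜 →+* ℂ where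
  toFun z := ⟨RCLike.re z, RCLike.im z⟩
  map_one' := by apply Complex.ext <;> simp
  map_mul' x y := by apply Complex.ext <;> simp
  map_zero' := by apply Complex.ext <;> simp
  map_add' x y := by apply Complex.ext <;> simp

variable {l m n : Type*}

theorem cplx_mul [Fintype m] (A : Matrix l m 𝕜) (B : Matrix m n 𝕜) :
    cplx (A * B) = cplx A * cplx B := Matrix.map_mul (f := toComplexHom 𝕜)

theorem cplx_add (A B : Matrix m n 𝕜) : cplx (A + B) = cplx A + cplx B :=
  Matrix.map_add _ (map_add (toComplexHom 𝕜)) A B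

theorem cplx_sub (A B : Matrix m n 𝕜) : cplx (A - B) = cplx A - cplx B :=
  Matrix.map_sub _ (map_sub (toComplexHom 𝕜)) A B

theorem cplx_zero : cplx (0 : Matrix m n 𝕜) = 0 := Matrix.map_zero _ (map_zero (toComplexHom 𝕜))

theorem cplx_one [DecidableEq n] : cplx (1 : Matrix n n 𝕜) = 1 :=
  Matrix.map_one _ (map_zero (toComplexHom 𝕜)) (map_one (toComplexHom 𝕜))

theorem IsInvertible.cplx [Fintype m] [Fintype n] [DecidableEq m] [DecidableEq n]
    {A : Matrix m n 𝕜} (h : IsInvertible A) : IsInvertible (cplx A) := by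
  obtain ⟨B, h1, h2⟩ := h
  exact ⟨PHPencil.cplx B, by rw [← cplx_mul, h1, cplx_one], by rw [← cplx_mul, h2, cplx_one]⟩

theorem cplx_blk {d : Fin 4 → ℕ} (M : Matrix (Idx d) (Idx d) 𝕜) (i j : Fin 4) :
    cplx (blk M i j) = blk (cplx M) i j := rfl

end Complexification

/-! ### Decoupling in the condensed form; inclusions of index groups -/

section Condensed

variable {d : Fin 4 → ℕ}

/-- The four groups of indices, arranged in the order `1, 4, 2, 3`. -/
noncomputable def groupEquiv (d : Fin 4 → ℕ) :
    (Fin (d 0) ⊕ Fin (d 3)) ⊕ (Fin (d 1) ⊕ Fin (d 2)) ≃ Idx d :=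
  Equiv.ofBijective (Sum.elim (Sum.elim (fun k => ⟨0, k⟩) fun k => ⟨3, k⟩)
    (Sum.elim (fun k => ⟨1, k⟩) fun k => ⟨2, k⟩) :
      (Fin (d 0) ⊕ Fin (d 3)) ⊕ (Fin (d 1) ⊕ Fin (d 2)) → Idx d) (by
    constructor
    · rintro ((i | i) | (i | i)) ((j | j) | (j | j)) h <;> simp_all
    · rintro ⟨i, k⟩
      fin_cases i
      exacts [⟨.inl (.inl k), rfl⟩, ⟨.inr (.inl k), rfl⟩, ⟨.inr (.inr k), rfl⟩,
        ⟨.inl (.inr k), rfl⟩])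

theorem submatrix_groupEquiv {R : Type*} (M : Matrix (Idx d) (Idx d) R) :
    M.submatrix (groupEquiv d) (groupEquiv d) =
      fromBlocks (fromBlocks (blk M 0 0) (blk M 0 3) (blk M 3 0) (blk M 3 3))
        (fromBlocks (blk M 0 1) (blk M 0 2) (blk M 3 1) (blk M 3 2))
        (fromBlocks (blk M 1 0) (blk M 1 3) (blk M 2 0) (blk M 2 3))
        (fromBlocks (blk M 1 1) (blk M 1 2) (blk M 2 1) (blk M 2 2)) := by
  ext ((i | i) | (i | i)) ((j | j) | (j | j)) <;> rfl

variable {𝕜 : Type*} [RCLike 𝕜] {n : ℕ} {E Q L : Matrix (Fin n) (Fin n) 𝕜}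
  {U : Matrix (Idx d) (Fin n) 𝕜} {X : Matrix (Fin n) (Idx d) 𝕜}

/-- A pencil `λ E - H` whose coefficient `H` differs from `L Q` in condensed form only in the third
block row splits into a part that does not depend on `H` and a square-zero part. -/
theorem IsCondensedForm.pencilEquiv (h : IsCondensedForm E Q L d U X) {H : Matrix (Fin n) (Fin n) ℂ}
    (hH : ∀ i ≠ 2, ∀ j, blk (cplx U * H * cplx X) i j = cplx (blk (U * (L * Q) * X) i j))
    (h22 : blk (cplx U * H * cplx X) 2 2 = 0) :
    PencilEquiv (cplx E) H
      (fromBlocks (fromBlocks (cplx (blk (U * E * X) 0 0)) 0 0 0) 0 0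
        (1 : Matrix (Fin (d 1) ⊕ Fin (d 2)) (Fin (d 1) ⊕ Fin (d 2)) ℂ))
      (fromBlocks (fromBlocks (cplx (blk (U * (L * Q) * X) 0 0))
          (cplx (blk (U * (L * Q) * X) 0 3)) 0 (cplx (blk (U * (L * Q) * X) 3 3))) 0 0
        (fromBlocks 0 0 (blk (cplx U * H * cplx X) 2 1) 0)) := by
  have hU : IsInvertible U := ⟨_, h.unitary⟩
  have h1 : PencilEquiv (cplx E) H (cplx (U * E * X)) (cplx U * H * cplx X) :=
    ⟨_, _, hU.cplx, h.invertible.cplx, by simp only [cplx_mul], rfl⟩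
  refine (h1.trans (.submatrix _ _ (groupEquiv d) (groupEquiv d))).trans ?_
  rw [submatrix_groupEquiv, submatrix_groupEquiv, h22, hH 0 (by decide), hH 0 (by decide),
    hH 0 (by decide), hH 0 (by decide), hH 1 (by decide), hH 1 (by decide), hH 1 (by decide),
    hH 1 (by decide), hH 3 (by decide), hH 3 (by decide), hH 3 (by decide), hH 3 (by decide)]
  -- In the order 1, 4 | 2, 3 the zero pattern makes both coefficients block lower triangular.
  simp only [← cplx_blk, h.E_row1, h.E_row2, h.E_row3, h.E_row4, h.A_row1, h.A_row2, h.A_row4,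
    cplx_zero, cplx_one, fromBlocks_zero]
  exact .block_triangular (h.A11.cplx.fromBlocks_upper h.A44.cplx _) h.E22.cplx _ _ _

/-- The inclusion of the third group of indices. -/
def incl3 (𝕜 : Type*) [RCLike 𝕜] (d : Fin 4 → ℕ) : Matrix (Idx d) (Fin (d 2)) 𝕜 :=
  (1 : Matrix (Idx d) (Idx d) 𝕜).submatrix id fun k => ⟨2, k⟩

/-- The inclusion of the indices that do not lie in the third group. -/
def incl124 (𝕜 : Type*) [RCLike 𝕜] (d : Fin 4 → ℕ) : Matrix (Idx d) (Idx124 d) 𝕜 :=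
  (1 : Matrix (Idx d) (Idx d) 𝕜).submatrix id Subtype.val

theorem incl3_conjTranspose_mul {l : Type*} (M : Matrix (Idx d) l 𝕜) :
    (incl3 𝕜 d)ᴴ * M = M.submatrix (fun k => ⟨2, k⟩) id := by
  ext i j
  simp [incl3, Matrix.mul_apply, Matrix.one_apply]

theorem mul_incl3 {l : Type*} (M : Matrix l (Idx d) 𝕜) :
    M * incl3 𝕜 d = M.submatrix id (fun k => ⟨2, k⟩) := by
  ext i j
  simp [incl3, Matrix.mul_apply, Matrix.one_apply]

theorem incl124_conjTranspose_mul {l : Type*} (M : Matrix (Idx d) l 𝕜) :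
    (incl124 𝕜 d)ᴴ * M = M.submatrix Subtype.val id := by
  ext i j
  simp [incl124, Matrix.mul_apply, Matrix.one_apply]

theorem mul_incl124 {l : Type*} (M : Matrix l (Idx d) 𝕜) :
    M * incl124 𝕜 d = M.submatrix id Subtype.val := by
  ext i j
  simp [incl124, Matrix.mul_apply, Matrix.one_apply]

theorem incl3_conjTranspose_mul_self : (incl3 𝕜 d)ᴴ * incl3 𝕜 d = 1 := by
  rw [incl3_conjTranspose_mul]
  ext i j
  simp [incl3, Matrix.one_apply]

theorem incl124_conjTranspose_mul_self : (incl124 𝕜 d)ᴴ * incl124 𝕜 d = 1 := by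
  rw [incl124_conjTranspose_mul]
  ext i j
  simp [incl124, Matrix.one_apply, Subtype.ext_iff]

theorem incl124_mul_apply_of_ne {l : Type*} (M : Matrix (Idx124 d) l 𝕜) {p : Idx d} (hp : p.1 ≠ 2)
    (j : l) : (incl124 𝕜 d * M) p j = M ⟨p, hp⟩ j := by
  rw [Matrix.mul_apply, Finset.sum_eq_single ⟨p, hp⟩]
  · change (1 : Matrix (Idx d) (Idx d) 𝕜) p p * _ = _
    rw [one_apply_eq, one_mul]
  · intro q _ hq
    have : p ≠ q.1 := fun h => hq (Subtype.ext h.symm)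
    simp [incl124, this]
  · simp

theorem incl124_mul_apply_of_eq {l : Type*} (M : Matrix (Idx124 d) l 𝕜) {p : Idx d} (hp : p.1 = 2)
    (j : l) : (incl124 𝕜 d * M) p j = 0 := by
  rw [Matrix.mul_apply, Finset.sum_eq_zero]
  intro q _
  have : p ≠ q.1 := fun h => q.2 (h ▸ hp)
  simp [incl124, this]

theorem incl3_mul_apply_of_ne {l : Type*} (M : Matrix (Fin (d 2)) l 𝕜) {p : Idx d} (hp : p.1 ≠ 2)
    (j : l) : (incl3 𝕜 d * M) p j = 0 := by
  rw [Matrix.mul_apply, Finset.sum_eq_zero]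
  intro k _
  have : p ≠ ⟨2, k⟩ := fun h => hp (congrArg Sigma.fst h)
  simp [incl3, this]

theorem incl3_mul_apply {l : Type*} (M : Matrix (Fin (d 2)) l 𝕜) (k : Fin (d 2)) (j : l) :
    (incl3 𝕜 d * M) ⟨2, k⟩ j = M k j := by
  simp [incl3, Matrix.mul_apply, Matrix.one_apply]

theorem incl124_mul_add_incl3_mul {l : Type*} (M : Matrix (Idx d) l 𝕜) :
    incl124 𝕜 d * ((incl124 𝕜 d)ᴴ * M) + incl3 𝕜 d * ((incl3 𝕜 d)ᴴ * M) = M := by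
  ext p j
  rw [Matrix.add_apply, incl124_conjTranspose_mul, incl3_conjTranspose_mul]
  by_cases hp : p.1 = 2
  · rw [incl124_mul_apply_of_eq _ hp]
    obtain ⟨i, k⟩ := p
    obtain rfl : i = 2 := hp
    rw [incl3_mul_apply]
    simp
  · rw [incl124_mul_apply_of_ne _ hp, incl3_mul_apply_of_ne _ hp]
    simp

theorem padRow_eq (Y : Matrix (Fin (d 2)) (Idx124 d) 𝕜) : padRow Y = Y * (incl124 𝕜 d)ᴴ := by
  rw [← conjTranspose_inj, conjTranspose_mul, conjTranspose_conjTranspose]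
  ext p i
  by_cases hp : p.1 = 2
  · rw [incl124_mul_apply_of_eq _ hp]
    simp [padRow, hp]
  · rw [incl124_mul_apply_of_ne _ hp]
    simp [padRow, hp]

theorem blk_incl3_mul_of_ne {i : Fin 4} (hi : i ≠ 2) (j : Fin 4)
    (Z : Matrix (Fin (d 2)) (Idx d) 𝕜) : blk (incl3 𝕜 d * Z) i j = 0 := by
  ext k l
  exact incl3_mul_apply_of_ne Z (p := ⟨i, k⟩) hi _

theorem blk_incl3_mul (j : Fin 4) (Z : Matrix (Fin (d 2)) (Idx d) 𝕜) :
    blk (incl3 𝕜 d * Z) 2 j = Z.submatrix id fun l => ⟨j, l⟩ := by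
  ext k l
  exact incl3_mul_apply Z k _

end Condensed

end PHPencil

namespace PHPencil

set_option linter.unusedSectionVars false

open Matrix
open scoped ComplexOrder Matrix.Norms.L2Operator

/-! ### Spectral norm, restriction to the image, square root -/

section Norms

variable {𝕜 : Type*} [RCLike 𝕜] {l m n : Type*} [Fintype l] [Fintype m] [Fintype n]
  [DecidableEq l] [DecidableEq m] [DecidableEq n]

theorem opNorm_eq_norm (A : Matrix m n 𝕜) : opNorm A = ‖A‖ := rfl

theorem opNorm_nonneg (A : Matrix m n 𝕜) : 0 ≤ opNorm A := norm_nonneg (E := Matrix m n 𝕜) A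

theorem norm_mulVec_le (A : Matrix m n 𝕜) (x : EuclideanSpace 𝕜 n) :
    ‖toEuclideanLin A x‖ ≤ ‖A‖ * ‖x‖ := l2_opNorm_mulVec A x

theorem toEuclideanLin_mul_apply (A : Matrix l m 𝕜) (B : Matrix m n 𝕜) (x : EuclideanSpace 𝕜 n) :
    toEuclideanLin (A * B) x = toEuclideanLin A (toEuclideanLin B x) := by
  simp [toLpLin_apply, mulVec_mulVec]

theorem opNorm_le_bound {A : Matrix m n 𝕜} {c : ℝ} (hc : 0 ≤ c)
    (h : ∀ x, ‖toEuclideanLin A x‖ ≤ c * ‖x‖) : ‖A‖ ≤ c :=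
  ContinuousLinearMap.opNorm_le_bound _ hc h

theorem norm_le_one_of_isometry {A : Matrix m n 𝕜} (h : Aᴴ * A = 1) : ‖A‖ ≤ 1 := by
  have h1 : ‖(1 : Matrix n n 𝕜)‖ ≤ 1 := by
    refine opNorm_le_bound zero_le_one fun x => ?_
    simp
  have h2 := l2_opNorm_conjTranspose_mul_self A
  rw [h] at h2
  nlinarith [norm_nonneg A]

theorem norm_mul_le_of_isometry_left {V : Matrix l m 𝕜} (h : Vᴴ * V = 1) (A : Matrix m n 𝕜) :
    ‖V * A‖ ≤ ‖A‖ :=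
  (l2_opNorm_mul _ _).trans
    (mul_le_of_le_one_left (norm_nonneg _) (norm_le_one_of_isometry h))

theorem norm_mul_le_of_isometry_right {V : Matrix l m 𝕜} (h : Vᴴ * V = 1) (A : Matrix n m 𝕜) :
    ‖A * Vᴴ‖ ≤ ‖A‖ := by
  rw [← l2_opNorm_conjTranspose, conjTranspose_mul, conjTranspose_conjTranspose,
    ← l2_opNorm_conjTranspose A]
  exact norm_mul_le_of_isometry_left h _

theorem normInvOnIm_nonneg (A : Matrix m m 𝕜) : 0 ≤ normInvOnIm A := by
  unfold normInvOnIm linNorm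
  positivity

/-- On `im A` the vector `x` is recovered from `A x` by the inverse of the restriction. -/
theorem norm_le_normInvOnIm_mul {A : Matrix m m 𝕜} (hA : A.IsHermitian) {x : EuclideanSpace 𝕜 m}
    (hx : x ∈ im A) : ‖x‖ ≤ normInvOnIm A * ‖toEuclideanLin A x‖ := by
  have h1 : Ring.inverse (restrictIm A) (restrictIm A ⟨x, hx⟩) = ⟨x, hx⟩ := by
    rw [← Module.End.mul_apply, Ring.inverse_mul_cancel _ (isUnit_restrictIm hA),
      Module.End.one_apply]
  have h2 := ContinuousLinearMap.le_opNorm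
    (LinearMap.toContinuousLinearMap (Ring.inverse (restrictIm A))) (restrictIm A ⟨x, hx⟩)
  rw [LinearMap.coe_toContinuousLinearMap', h1] at h2
  exact h2

theorem norm_matrix_le_normInvOnIm_mul {A : Matrix m m 𝕜} (hA : A.IsHermitian) {M : Matrix m n 𝕜}
    (hM : im M ≤ im A) : ‖M‖ ≤ normInvOnIm A * ‖A * M‖ := by
  refine opNorm_le_bound (mul_nonneg (normInvOnIm_nonneg A) (norm_nonneg _)) fun x => ?_
  refine (norm_le_normInvOnIm_mul hA (hM (LinearMap.mem_range_self _ x))).trans ?_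
  rw [← toEuclideanLin_mul_apply, mul_assoc]
  exact mul_le_mul_of_nonneg_left (norm_mulVec_le _ x) (normInvOnIm_nonneg A)

/-- The solution `(A|_{im A})⁻¹ M` is the one with columns in `im A`; this is what makes it
controllable by `normInvOnIm A`. -/
theorem exists_mul_eq_of_im_le {A : Matrix m m 𝕜} (hA : A.IsHermitian) {M : Matrix m n 𝕜}
    (hM : im M ≤ im A) : ∃ Z : Matrix m n 𝕜, A * Z = M ∧ im Z ≤ im A := by
  let f : EuclideanSpace 𝕜 n →ₗ[𝕜] im A := (toEuclideanLin M).codRestrict (im A)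
    fun x => hM (LinearMap.mem_range_self _ x)
  let g : EuclideanSpace 𝕜 n →ₗ[𝕜] EuclideanSpace 𝕜 m :=
    (im A).subtype ∘ₗ Ring.inverse (restrictIm A) ∘ₗ f
  have hg : toEuclideanLin (toEuclideanLin.symm g) = g := LinearEquiv.apply_symm_apply _ _
  refine ⟨toEuclideanLin.symm g, ?_, ?_⟩
  · apply toEuclideanLin.injective
    ext1 x
    rw [toEuclideanLin_mul_apply, hg]
    have h1 : restrictIm A (Ring.inverse (restrictIm A) (f x)) = f x := by
      rw [← Module.End.mul_apply, Ring.mul_inverse_cancel _ (isUnit_restrictIm hA),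
        Module.End.one_apply]
    exact congrArg Subtype.val h1
  · rintro _ ⟨x, rfl⟩
    rw [hg]
    exact (Ring.inverse (restrictIm A) (f x)).2

theorem im_mul_le (A : Matrix l m 𝕜) (B : Matrix m n 𝕜) : im (A * B) ≤ im A := by
  rintro _ ⟨x, rfl⟩
  rw [toEuclideanLin_mul_apply]
  exact LinearMap.mem_range_self _ _

section Sqrt

open scoped MatrixOrder

theorem psdSqrt_isHermitian (A : Matrix m m 𝕜) : (psdSqrt A).IsHermitian :=
  (CFC.sqrt_nonneg A).isSelfAdjoint

theorem psdSqrt_mul_self {A : Matrix m m 𝕜} (hA : A.PosSemidef) : psdSqrt A * psdSqrt A = A :=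
  CFC.sqrt_mul_sqrt_self A hA.nonneg

theorem exists_conjTranspose_mul_self_eq {A : Matrix m m 𝕜} (hA : A.PosSemidef) :
    ∃ B : Matrix m m 𝕜, A = Bᴴ * B :=
  ⟨psdSqrt A, by rw [psdSqrt_isHermitian A, psdSqrt_mul_self hA]⟩

end Sqrt

/-! ### The Frobenius norm -/

/-- The trace form makes invariance under isometries immediate. -/
theorem frobNorm_sq (A : Matrix m n 𝕜) : ((frobNorm A ^ 2 : ℝ) : 𝕜) = (Aᴴ * A).trace := by
  rw [frobNorm, Real.sq_sqrt (by positivity), Matrix.trace, Finset.sum_comm]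
  push_cast
  refine Finset.sum_congr rfl fun j _ => ?_
  rw [diag_apply, Matrix.mul_apply]
  refine Finset.sum_congr rfl fun i _ => ?_
  rw [conjTranspose_apply, RCLike.star_def, RCLike.conj_mul]

theorem frobNorm_nonneg (A : Matrix m n 𝕜) : 0 ≤ frobNorm A := Real.sqrt_nonneg _

theorem frobNorm_conjTranspose (A : Matrix m n 𝕜) : frobNorm Aᴴ = frobNorm A := by
  unfold frobNorm
  rw [Finset.sum_comm]
  simp

theorem frobNorm_neg (A : Matrix m n 𝕜) : frobNorm (-A) = frobNorm A := by
  simp [frobNorm]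

theorem frobNorm_sub_le (A B : Matrix m n 𝕜) : frobNorm (A - B) ≤ frobNorm A + frobNorm B := by
  let e : Matrix m n 𝕜 → EuclideanSpace 𝕜 (m × n) := fun A => WithLp.toLp 2 fun p => A p.1 p.2
  have he (A : Matrix m n 𝕜) : frobNorm A = ‖e A‖ := by
    rw [frobNorm, EuclideanSpace.norm_eq, Fintype.sum_prod_type]
  have hsub : e (A - B) = e A - e B := by ext; simp [e]
  rw [he, he, he, hsub]
  exact norm_sub_le _ _

theorem frobNorm_mul_of_isometry_left {V : Matrix l m 𝕜} (h : Vᴴ * V = 1) (A : Matrix m n 𝕜) :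
    frobNorm (V * A) = frobNorm A := by
  have h1 : ((frobNorm (V * A) ^ 2 : ℝ) : 𝕜) = ((frobNorm A ^ 2 : ℝ) : 𝕜) := by
    rw [frobNorm_sq, frobNorm_sq, conjTranspose_mul, Matrix.mul_assoc, ← Matrix.mul_assoc Vᴴ, h,
      Matrix.one_mul]
  exact (pow_left_inj₀ (frobNorm_nonneg _) (frobNorm_nonneg _) two_ne_zero).mp
    (RCLike.ofReal_injective h1)

theorem frobNorm_mul_of_isometry_right {V : Matrix l m 𝕜} (h : Vᴴ * V = 1) (A : Matrix n m 𝕜) :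
    frobNorm (A * Vᴴ) = frobNorm A := by
  rw [← frobNorm_conjTranspose, conjTranspose_mul, conjTranspose_conjTranspose,
    frobNorm_mul_of_isometry_left h, frobNorm_conjTranspose]

/-! ### Orthogonal projections -/

theorem toEuclideanLin_projMatrix (V : Submodule 𝕜 (EuclideanSpace 𝕜 m))
    (x : EuclideanSpace 𝕜 m) : toEuclideanLin (projMatrix V) x = V.starProjection x := by
  rw [projMatrix, LinearEquiv.apply_symm_apply]
  rfl

theorem projMatrix_isHermitian (V : Submodule 𝕜 (EuclideanSpace 𝕜 m)) :
    (projMatrix V).IsHermitian := by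
  rw [← isSymmetric_toEuclideanLin_iff]
  intro x y
  rw [toEuclideanLin_projMatrix, toEuclideanLin_projMatrix]
  exact V.starProjection_isSymmetric x y

theorem projMatrix_im_mul (A : Matrix m n 𝕜) : projMatrix (im A) * A = A := by
  apply toEuclideanLin.injective
  ext1 x
  rw [toEuclideanLin_mul_apply, toEuclideanLin_projMatrix]
  exact Submodule.starProjection_eq_self_iff.mpr (LinearMap.mem_range_self _ x)

end Norms

end PHPencil

namespace PHPencil

open Matrix
open scoped ComplexOrder Matrix.Norms.L2Operator

/-! ### Structured perturbations and their bounds -/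

section Perturbation

variable {𝕜 : Type*} [RCLike 𝕜] {d : Fin 4 → ℕ}

/-- The Hermitian perturbation `[0 -Y*; -Y K]` in the coordinates of the condensed form. -/
def hermitianPerturbation (Y : Matrix (Fin (d 2)) (Idx124 d) 𝕜)
    (K : Matrix (Fin (d 2)) (Fin (d 2)) 𝕜) : Matrix (Idx d) (Idx d) 𝕜 :=
  incl3 𝕜 d * (K * (incl3 𝕜 d)ᴴ) - incl3 𝕜 d * padRow Y - (padRow Y)ᴴ * (incl3 𝕜 d)ᴴ

/-- A positive semidefinite matrix stays positive semidefinite under the perturbation of its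
off-diagonal blocks by `-Y`, if the third diagonal block is increased suitably. -/
theorem exists_posSemidef_add_hermitianPerturbation {R : Matrix (Idx d) (Idx d) 𝕜}
    (hR : R.PosSemidef) {Y : Matrix (Fin (d 2)) (Idx124 d) 𝕜} (hY : im Yᴴ ≤ im (sub124 R)) :
    ∃ K : Matrix (Fin (d 2)) (Fin (d 2)) 𝕜, Kᴴ = K ∧ (R + hermitianPerturbation Y K).PosSemidef ∧
      ‖K‖ ≤ normInvOnIm (sub124 R) * ‖Y‖ * ‖Y‖ +
        2 * (normInvOnIm (psdSqrt (sub124 R)) * ‖Y‖ * √‖blk R 2 2‖) := by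
  let V := incl124 𝕜 d
  let W := incl3 𝕜 d
  have hRH : Rᴴ = R := hR.isHermitian
  have hsub : sub124 R = Vᴴ * R * V := by
    rw [mul_incl124, incl124_conjTranspose_mul]
    rfl
  have hblk : blk R 2 2 = Wᴴ * R * W := by
    rw [mul_incl3, incl3_conjTranspose_mul]
    rfl
  have hR0 : (sub124 R).PosSemidef := hR.submatrix _
  have hR0H : (sub124 R).IsHermitian := hR0.isHermitian
  obtain ⟨Z, hZ, hZim⟩ := exists_mul_eq_of_im_le hR0H hY
  have hZ' : Zᴴ * sub124 R = Y := by
    rw [← conjTranspose_inj, conjTranspose_mul, conjTranspose_conjTranspose, hR0H.eq, hZ]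
  obtain ⟨C, hC⟩ : ∃ C, C = Wᴴ * (R * (V * Z)) := ⟨_, rfl⟩
  -- Outside the third group the rows of `R V Z` form `R₀ Z = Yᴴ`; `C` collects the rows of the
  -- third group.
  have hRVZ : R * (V * Z) = (padRow Y)ᴴ + W * C := by
    rw [← incl124_mul_add_incl3_mul (R * (V * Z)), hC, padRow_eq, conjTranspose_mul,
      conjTranspose_conjTranspose, ← hZ, hsub]
    simp only [Matrix.mul_assoc]
    rfl
  have hVZR : Zᴴ * (Vᴴ * R) = padRow Y + Cᴴ * Wᴴ := by
    rw [← conjTranspose_inj]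
    simpa [hRH, Matrix.mul_assoc] using hRVZ
  have hquad : Zᴴ * (Vᴴ * (R * (V * Z))) = Zᴴ * Yᴴ := by
    rw [← hZ, hsub]
    simp only [Matrix.mul_assoc]
  have hquadH : (Zᴴ * Yᴴ)ᴴ = Zᴴ * Yᴴ := by
    rw [← hquad]
    simp [hRH, Matrix.mul_assoc]
  -- This `K` is what the congruence of `R` by `1 - W Zᴴ Vᴴ` adds to the third diagonal block: the
  -- quadratic term `Zᴴ R₀ Z = Zᴴ Yᴴ` minus the two cross terms.
  refine ⟨Zᴴ * Yᴴ - C - Cᴴ, ?_, ?_, ?_⟩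
  · rw [conjTranspose_sub, conjTranspose_sub, hquadH, conjTranspose_conjTranspose]
    abel
  · have h1 : R + hermitianPerturbation Y (Zᴴ * Yᴴ - C - Cᴴ) =
        (1 - W * (Zᴴ * Vᴴ)) * R * (1 - W * (Zᴴ * Vᴴ))ᴴ := by
      have h2 : (1 - W * (Zᴴ * Vᴴ))ᴴ = 1 - V * Z * Wᴴ := by
        simp [Matrix.mul_assoc]
      have h3 : W * (Zᴴ * Vᴴ) * R = W * (padRow Y + Cᴴ * Wᴴ) := by
        rw [← hVZR]
        simp only [Matrix.mul_assoc]
      have h4 : R * (V * Z * Wᴴ) = ((padRow Y)ᴴ + W * C) * Wᴴ := by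
        rw [← hRVZ]
        simp only [Matrix.mul_assoc]
      have h5 : W * (Zᴴ * Vᴴ) * R * (V * Z * Wᴴ) = W * (Zᴴ * Yᴴ * Wᴴ) := by
        rw [← hquad]
        simp only [Matrix.mul_assoc]
      rw [h2, Matrix.mul_sub, Matrix.mul_one, Matrix.sub_mul, Matrix.one_mul, Matrix.sub_mul, h5,
        h3, h4, hermitianPerturbation]
      simp only [Matrix.sub_mul, Matrix.mul_sub, Matrix.add_mul, Matrix.mul_add, Matrix.mul_assoc]
      change R + (W * (Zᴴ * (Yᴴ * Wᴴ)) - W * (C * Wᴴ) - W * (Cᴴ * Wᴴ) - W * padRow Y -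
        (padRow Y)ᴴ * Wᴴ) = _
      abel
    rw [h1]
    exact hR.mul_mul_conjTranspose_same _
  · have hZn : ‖Z‖ ≤ normInvOnIm (sub124 R) * ‖Y‖ := by
      have := norm_matrix_le_normInvOnIm_mul hR0H hZim
      rwa [hZ, l2_opNorm_conjTranspose] at this
    have hSZ : ‖psdSqrt (sub124 R) * Z‖ ≤ normInvOnIm (psdSqrt (sub124 R)) * ‖Y‖ := by
      have := norm_matrix_le_normInvOnIm_mul (psdSqrt_isHermitian (sub124 R))
        (im_mul_le (psdSqrt (sub124 R)) Z)
      rwa [← Matrix.mul_assoc, psdSqrt_mul_self hR0, hZ, l2_opNorm_conjTranspose] at this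
    -- Cauchy–Schwarz for the form `R = Bᴴ B`: `C = (B W)ᴴ (B V Z)`, where `B W` has Gram matrix
    -- `R₃₃`, and `B V Z` has the same Gram matrix as `R₀^(1/2) Z`.
    have hCn : ‖C‖ ≤ normInvOnIm (psdSqrt (sub124 R)) * ‖Y‖ * √‖blk R 2 2‖ := by
      obtain ⟨B, hB⟩ := exists_conjTranspose_mul_self_eq hR
      have h1 : C = (B * W)ᴴ * (B * (V * Z)) := by
        rw [hC, hB, conjTranspose_mul]
        simp only [Matrix.mul_assoc]
      have h2 : ‖(B * W)ᴴ‖ = √‖blk R 2 2‖ := by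
        have h8 : blk R 2 2 = (B * W)ᴴ * (B * W) := by
          rw [hblk, hB, conjTranspose_mul]
          simp only [Matrix.mul_assoc]
        rw [l2_opNorm_conjTranspose, h8, l2_opNorm_conjTranspose_mul_self,
          Real.sqrt_mul_self (norm_nonneg _)]
      have h3 : ‖B * (V * Z)‖ = ‖psdSqrt (sub124 R) * Z‖ := by
        have h4 : (B * (V * Z))ᴴ * (B * (V * Z)) =
            (psdSqrt (sub124 R) * Z)ᴴ * (psdSqrt (sub124 R) * Z) := by
          have h5 : (psdSqrt (sub124 R) * Z)ᴴ * (psdSqrt (sub124 R) * Z) =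
              Zᴴ * (psdSqrt (sub124 R) * psdSqrt (sub124 R) * Z) := by
            rw [conjTranspose_mul, (psdSqrt_isHermitian _).eq]
            simp only [Matrix.mul_assoc]
          rw [h5, psdSqrt_mul_self hR0, hsub, hB]
          simp only [conjTranspose_mul, Matrix.mul_assoc]
        have h6 := congrArg norm h4
        rw [l2_opNorm_conjTranspose_mul_self, l2_opNorm_conjTranspose_mul_self] at h6
        exact (mul_self_inj (norm_nonneg _) (norm_nonneg _)).mp h6
      rw [h1]
      refine (l2_opNorm_mul _ _).trans ?_
      rw [h2, h3, mul_comm]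
      exact mul_le_mul_of_nonneg_right hSZ (Real.sqrt_nonneg _)
    have hZY : ‖Zᴴ * Yᴴ‖ ≤ normInvOnIm (sub124 R) * ‖Y‖ * ‖Y‖ := by
      refine (l2_opNorm_mul _ _).trans ?_
      rw [l2_opNorm_conjTranspose, l2_opNorm_conjTranspose]
      exact mul_le_mul_of_nonneg_right hZn (norm_nonneg _)
    have h7 : ‖Zᴴ * Yᴴ - C - Cᴴ‖ ≤ ‖Zᴴ * Yᴴ‖ + ‖C‖ + ‖C‖ := by
      refine (norm_sub_le _ _).trans ?_
      rw [l2_opNorm_conjTranspose]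
      exact add_le_add_left (norm_sub_le _ _) _
    linarith

theorem norm_hermitianPerturbation_le (Y : Matrix (Fin (d 2)) (Idx124 d) 𝕜)
    (K : Matrix (Fin (d 2)) (Fin (d 2)) 𝕜) :
    ‖hermitianPerturbation Y K‖ ≤ ‖K‖ + 2 * ‖Y‖ := by
  have hpad : ‖incl3 𝕜 d * padRow Y‖ ≤ ‖Y‖ := by
    refine (norm_mul_le_of_isometry_left incl3_conjTranspose_mul_self _).trans ?_
    rw [padRow_eq]
    exact norm_mul_le_of_isometry_right incl124_conjTranspose_mul_self _
  have hK : ‖incl3 𝕜 d * (K * (incl3 𝕜 d)ᴴ)‖ ≤ ‖K‖ :=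
    (norm_mul_le_of_isometry_left incl3_conjTranspose_mul_self _).trans
      (norm_mul_le_of_isometry_right incl3_conjTranspose_mul_self _)
  have hpad' : ‖(padRow Y)ᴴ * (incl3 𝕜 d)ᴴ‖ ≤ ‖Y‖ := by
    have h0 : (padRow Y)ᴴ * (incl3 𝕜 d)ᴴ = (incl3 𝕜 d * padRow Y)ᴴ :=
      (conjTranspose_mul _ _).symm
    rw [h0, l2_opNorm_conjTranspose]
    exact hpad
  have h1 := norm_sub_le (incl3 𝕜 d * (K * (incl3 𝕜 d)ᴴ) - incl3 𝕜 d * padRow Y)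
    ((padRow Y)ᴴ * (incl3 𝕜 d)ᴴ)
  have h2 := norm_sub_le (incl3 𝕜 d * (K * (incl3 𝕜 d)ᴴ)) (incl3 𝕜 d * padRow Y)
  unfold hermitianPerturbation
  linarith

theorem opNorm_conj_hermitianPerturbation_le {n : ℕ} {U : Matrix (Idx d) (Fin n) 𝕜}
    (hU : U * Uᴴ = 1) {Y : Matrix (Fin (d 2)) (Idx124 d) 𝕜} {K : Matrix (Fin (d 2)) (Fin (d 2)) 𝕜}
    {a b r : ℝ} (ha : 0 ≤ a) (hb : 0 ≤ b) (hr : 0 ≤ r)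
    (hK : ‖K‖ ≤ a * ‖Y‖ * ‖Y‖ + 2 * (b * ‖Y‖ * √r)) :
    opNorm (Uᴴ * hermitianPerturbation Y K * U) ≤
      2 * opNorm Y + (a * opNorm Y + 2 * b * √(opNorm Y)) * (r + opNorm Y) := by
  simp only [opNorm_eq_norm]
  have hU' : Uᴴᴴ * Uᴴ = 1 := by rw [conjTranspose_conjTranspose, hU]
  have h1 : ‖Uᴴ * hermitianPerturbation Y K * U‖ ≤ ‖hermitianPerturbation Y K‖ := by
    have h2 := norm_mul_le_of_isometry_right hU' (Uᴴ * hermitianPerturbation Y K)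
    rw [conjTranspose_conjTranspose] at h2
    exact h2.trans (norm_mul_le_of_isometry_left hU' _)
  have h3 := norm_hermitianPerturbation_le Y K
  have hy := norm_nonneg Y
  have h4 : a * ‖Y‖ * ‖Y‖ ≤ a * ‖Y‖ * (r + ‖Y‖) :=
    mul_le_mul_of_nonneg_left (by linarith) (mul_nonneg ha hy)
  -- Split off one factor `√‖Y‖` and use the arithmetic–geometric mean inequality; this turns the
  -- sharper bound on `K` into the stated one.
  have h5 : ‖Y‖ * √r ≤ √‖Y‖ * (r + ‖Y‖) := by
    have h6 : √‖Y‖ * √r ≤ r + ‖Y‖ := by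
      nlinarith [Real.sq_sqrt hr, Real.sq_sqrt hy, sq_nonneg (√‖Y‖ - √r), sq_nonneg (√‖Y‖ + √r)]
    calc ‖Y‖ * √r = √‖Y‖ * (√‖Y‖ * √r) := by rw [← mul_assoc, Real.mul_self_sqrt hy]
      _ ≤ _ := mul_le_mul_of_nonneg_left h6 (Real.sqrt_nonneg _)
  have h7 := mul_le_mul_of_nonneg_left h5 hb
  linarith

theorem hermitianPerturbation_isHermitian (Y : Matrix (Fin (d 2)) (Idx124 d) 𝕜)
    {K : Matrix (Fin (d 2)) (Fin (d 2)) 𝕜} (hK : Kᴴ = K) :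
    (hermitianPerturbation Y K)ᴴ = hermitianPerturbation Y K := by
  unfold hermitianPerturbation
  simp only [conjTranspose_sub, conjTranspose_mul, conjTranspose_conjTranspose, hK,
    Matrix.mul_assoc]
  abel

/-- The skew-Hermitian perturbation whose third block row is `N` and whose third block column is
`-Nᴴ`, if the third block of `N` vanishes. -/
def skewPerturbation (N : Matrix (Fin (d 2)) (Idx d) 𝕜) : Matrix (Idx d) (Idx d) 𝕜 :=
  incl3 𝕜 d * N - Nᴴ * (incl3 𝕜 d)ᴴ

theorem skewPerturbation_conjTranspose (N : Matrix (Fin (d 2)) (Idx d) 𝕜) :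
    (skewPerturbation N)ᴴ = -skewPerturbation N := by
  simp [skewPerturbation]

theorem frobNorm_skewPerturbation_le (N : Matrix (Fin (d 2)) (Idx d) 𝕜) :
    frobNorm (skewPerturbation N) ≤ 2 * frobNorm N := by
  have h1 := frobNorm_sub_le (incl3 𝕜 d * N) (Nᴴ * (incl3 𝕜 d)ᴴ)
  rw [frobNorm_mul_of_isometry_left incl3_conjTranspose_mul_self,
    frobNorm_mul_of_isometry_right incl3_conjTranspose_mul_self, frobNorm_conjTranspose] at h1
  unfold skewPerturbation
  linarith

/-- The part `Nᴴ`, present only for skew-symmetry, meets the vanishing third block row of `Q` and is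
invisible to the pencil. -/
theorem skewPerturbation_mul {N : Matrix (Fin (d 2)) (Idx d) 𝕜} {Q : Matrix (Idx d) (Idx d) 𝕜}
    (hQ : (incl3 𝕜 d)ᴴ * Q = 0) : skewPerturbation N * Q = incl3 𝕜 d * (N * Q) := by
  rw [skewPerturbation, Matrix.sub_mul, Matrix.mul_assoc, Matrix.mul_assoc, hQ, Matrix.mul_zero,
    sub_zero]

/-- The correction `K` and the block `-Yᴴ` are annihilated by `Q`, so `K` can be chosen for
semidefiniteness alone. -/
theorem hermitianPerturbation_mul {Y : Matrix (Fin (d 2)) (Idx124 d) 𝕜}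
    {K : Matrix (Fin (d 2)) (Fin (d 2)) 𝕜} {Q : Matrix (Idx d) (Idx d) 𝕜}
    (hQ : (incl3 𝕜 d)ᴴ * Q = 0) :
    hermitianPerturbation Y K * Q = incl3 𝕜 d * (-padRow Y * Q) := by
  rw [hermitianPerturbation, Matrix.sub_mul, Matrix.sub_mul]
  simp only [Matrix.mul_assoc, hQ, Matrix.mul_zero, sub_zero, zero_sub, Matrix.neg_mul,
    Matrix.mul_neg]

end Perturbation

end PHPencil

namespace PHPencil

open Matrix

/-! ### The perturbed pencil in condensed coordinates -/

section PerturbedPencil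

variable {𝕜 : Type*} [RCLike 𝕜] {n : ℕ} {d : Fin 4 → ℕ} {E Q J R : Matrix (Fin n) (Fin n) 𝕜}
  {U : Matrix (Idx d) (Fin n) 𝕜} {X : Matrix (Fin n) (Idx d) 𝕜}

theorem IsCondensedForm.incl3_conjTranspose_mul (h : IsCondensedForm E Q (J - R) d U X) :
    (incl3 𝕜 d)ᴴ * (U * Q * X) = 0 := by
  rw [PHPencil.incl3_conjTranspose_mul]
  ext k ⟨j, l⟩
  exact congrFun (congrFun (h.Q_row3 j) k) l

/-- This keeps the (3,3) block of the perturbed coefficient zero, hence the second summand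
square-zero. -/
theorem IsCondensedForm.third_block_column (h : IsCondensedForm E Q (J - R) d U X)
    (Z : Matrix (Fin (d 2)) (Idx d) 𝕜) :
    (Z * (U * Q * X)).submatrix id (fun l => (⟨2, l⟩ : Idx d)) = 0 := by
  ext k l
  rw [submatrix_apply, Matrix.mul_apply, Matrix.zero_apply]
  refine Finset.sum_eq_zero fun p _ => ?_
  have hp : (U * Q * X) p ⟨2, l⟩ = 0 := by
    obtain ⟨i, m⟩ := p
    fin_cases i
    exacts [congrFun (congrFun h.Q_row1.1 m) l, congrFun (congrFun h.Q_row2.1 m) l,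
      congrFun (congrFun (h.Q_row3 2) m) l, congrFun (congrFun h.Q_row4.1 m) l]
  rw [hp, mul_zero]

/-- The coefficient `(J + s ΔJ - R - t ΔR) Q` in the coordinates of the condensed form. -/
theorem IsCondensedForm.perturbed_eq (h : IsCondensedForm E Q (J - R) d U X)
    (N : Matrix (Fin (d 2)) (Idx d) 𝕜) (Y : Matrix (Fin (d 2)) (Idx124 d) 𝕜)
    (K : Matrix (Fin (d 2)) (Fin (d 2)) 𝕜) (s t : ℂ) :
    cplx U * ((cplx J + s • cplx (Uᴴ * skewPerturbation N * U) - cplx R -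
        t • cplx (Uᴴ * hermitianPerturbation Y K * U)) * cplx Q) * cplx X =
      cplx (U * ((J - R) * Q) * X) + s • cplx (incl3 𝕜 d * (N * (U * Q * X))) +
        t • cplx (incl3 𝕜 d * (padRow Y * (U * Q * X))) := by
  have key (D : Matrix (Idx d) (Idx d) 𝕜) :
      cplx U * (cplx (Uᴴ * D * U) * cplx Q) * cplx X = cplx (D * (U * Q * X)) := by
    rw [← cplx_mul, ← cplx_mul, ← cplx_mul]
    congr 1
    calc U * (Uᴴ * D * U * Q) * X = U * Uᴴ * (D * (U * Q * X)) := by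
          simp only [Matrix.mul_assoc]
      _ = _ := by rw [h.unitary.1, Matrix.one_mul]
  have hneg : hermitianPerturbation Y K * (U * Q * X) =
      0 - incl3 𝕜 d * (padRow Y * (U * Q * X)) := by
    rw [hermitianPerturbation_mul h.incl3_conjTranspose_mul, Matrix.neg_mul, Matrix.mul_neg,
      zero_sub]
  have h1 := key (skewPerturbation N)
  have h2 := key (hermitianPerturbation Y K)
  rw [skewPerturbation_mul h.incl3_conjTranspose_mul] at h1
  rw [hneg, cplx_sub, cplx_zero, zero_sub] at h2
  have h3 : cplx (U * ((J - R) * Q) * X) =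
      cplx U * (cplx J * cplx Q) * cplx X - cplx U * (cplx R * cplx Q) * cplx X := by
    rw [cplx_mul, cplx_mul, cplx_mul, cplx_sub, Matrix.sub_mul, Matrix.mul_sub, Matrix.sub_mul]
  rw [h3, ← h1, eq_neg_of_add_eq_zero_left (a := cplx (incl3 𝕜 d * (padRow Y * (U * Q * X))))
    (b := cplx U * (cplx (Uᴴ * hermitianPerturbation Y K * U) * cplx Q) * cplx X)
    (by rw [h2, add_neg_cancel])]
  simp only [Matrix.sub_mul, Matrix.add_mul, Matrix.mul_add, Matrix.mul_sub, Matrix.smul_mul,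
    Matrix.mul_smul, smul_neg]
  abel

theorem blk_mul_row3_col2 (A B : Matrix (Idx d) (Idx d) 𝕜) :
    blk (A * B) 2 1 = row3 A * col2 B := rfl

theorem mul_col2 (Z : Matrix (Fin (d 2)) (Idx d) 𝕜) (B : Matrix (Idx d) (Idx d) 𝕜) :
    (Z * B).submatrix id (fun l => (⟨1, l⟩ : Idx d)) = Z * col2 B := rfl

/-- The summand without the eigenvalue zero is the same for all `s`, `t`; the parameters enter only
through one block of the nilpotent summand, in which they are affine. -/
theorem IsCondensedForm.perturbed_pencilEquiv (h : IsCondensedForm E Q (J - R) d U X)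
    (N : Matrix (Fin (d 2)) (Idx d) 𝕜) (Y : Matrix (Fin (d 2)) (Idx124 d) 𝕜)
    (K : Matrix (Fin (d 2)) (Fin (d 2)) 𝕜) (s t : ℂ) :
    PencilEquiv (cplx E) ((cplx J + s • cplx (Uᴴ * skewPerturbation N * U) - cplx R -
        t • cplx (Uᴴ * hermitianPerturbation Y K * U)) * cplx Q)
      (fromBlocks (fromBlocks (cplx (blk (U * E * X) 0 0)) 0 0 0) 0 0
        (1 : Matrix (Fin (d 1) ⊕ Fin (d 2)) (Fin (d 1) ⊕ Fin (d 2)) ℂ))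
      (fromBlocks (fromBlocks (cplx (blk (U * ((J - R) * Q) * X) 0 0))
          (cplx (blk (U * ((J - R) * Q) * X) 0 3)) 0
          (cplx (blk (U * ((J - R) * Q) * X) 3 3))) 0 0
        (fromBlocks 0 0 (cplx (row3 (U * (J - R) * Uᴴ) * col2 (U * Q * X)) +
          s • cplx (N * col2 (U * Q * X)) + t • cplx (padRow Y * col2 (U * Q * X))) 0)) := by
  have hblk (i j : Fin 4) : blk (cplx U * ((cplx J + s • cplx (Uᴴ * skewPerturbation N * U) -
        cplx R - t • cplx (Uᴴ * hermitianPerturbation Y K * U)) * cplx Q) * cplx X) i j =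
      cplx (blk (U * ((J - R) * Q) * X) i j) +
        s • cplx (blk (incl3 𝕜 d * (N * (U * Q * X))) i j) +
        t • cplx (blk (incl3 𝕜 d * (padRow Y * (U * Q * X))) i j) := by
    rw [h.perturbed_eq]
    rfl
  have h21 : blk (U * ((J - R) * Q) * X) 2 1 = row3 (U * (J - R) * Uᴴ) * col2 (U * Q * X) := by
    rw [← blk_mul_row3_col2]
    refine congrArg (fun M => blk M 2 1) ?_
    calc U * ((J - R) * Q) * X = U * (J - R) * (1 : Matrix (Fin n) (Fin n) 𝕜) * Q * X := by
          rw [Matrix.mul_one]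
          simp only [Matrix.mul_assoc]
      _ = U * (J - R) * Uᴴ * (U * Q * X) := by
          rw [← h.unitary.2]
          simp only [Matrix.mul_assoc]
  have h1 := h.pencilEquiv (H := (cplx J + s • cplx (Uᴴ * skewPerturbation N * U) -
        cplx R - t • cplx (Uᴴ * hermitianPerturbation Y K * U)) * cplx Q)
    (fun i hi j => by
      rw [hblk, blk_incl3_mul_of_ne hi, blk_incl3_mul_of_ne hi, cplx_zero, smul_zero, smul_zero,
        add_zero, add_zero])
    (by
      rw [hblk, blk_incl3_mul, blk_incl3_mul, h.third_block_column, h.third_block_column,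
        h.A_row3, cplx_zero, smul_zero, smul_zero, add_zero, add_zero])
  rwa [hblk, blk_incl3_mul, blk_incl3_mul, mul_col2, mul_col2, h21] at h1

end PerturbedPencil

end PHPencil

/-! ### Choice of the perturbations and conclusion -/

open PHPencil Matrix in
open scoped ComplexOrder in
theorem theorem5p7 {𝕜 : Type*} [RCLike 𝕜] {n : ℕ}
    (E Q J R : Matrix (Fin n) (Fin n) 𝕜)
    (hJ : Jᴴ = -J) (hR : R.PosSemidef)
    (hEQ : Eᴴ * Q = Qᴴ * E) (hpos : (Qᴴ * E).PosSemidef)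
    (hreg : IsRegular (cplx E) (cplx (J - R) * cplx Q))
    (hind : IndexAtMost (cplx E) (cplx (J - R) * cplx Q) 1)
    (d : Fin 4 → ℕ) (U : Matrix (Idx d) (Fin n) 𝕜) (X : Matrix (Fin n) (Idx d) 𝕜)
    (hform : IsCondensedForm E Q (J - R) d U X)
    (Y : Matrix (Fin (d 2)) (Idx124 d) 𝕜)
    (hY : im Yᴴ ≤ im (sub124 (U * R * Uᴴ))) :
    ∃ ΔR ΔJ : Matrix (Fin n) (Fin n) 𝕜,
      ΔRᴴ = ΔR ∧ (R + ΔR).PosSemidef ∧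
      opNorm ΔR ≤ 2 * opNorm Y +
        (normInvOnIm (sub124 (U * R * Uᴴ)) * opNorm Y +
          2 * normInvOnIm (psdSqrt (sub124 (U * R * Uᴴ))) * √(opNorm Y)) *
        (opNorm (blk (U * R * Uᴴ) 2 2) + opNorm Y) ∧
      ΔJᴴ = -ΔJ ∧
      frobNorm ΔJ ≤ 2 * frobNorm (projMatrix (im (col2 (U * Q * X))) *
        ((row3 (U * (J - R) * Uᴴ))ᴴ + (padRow Y)ᴴ)) ∧
      (∀ s t : ℂ,
        IsRegular (cplx E) ((cplx J + s • cplx ΔJ - cplx R - t • cplx ΔR) * cplx Q) ∧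
        SameNonzeroKroneckerStructure (cplx E) (cplx (J - R) * cplx Q)
          (cplx E) ((cplx J + s • cplx ΔJ - cplx R - t • cplx ΔR) * cplx Q)) ∧
      (IsEigenvalue (cplx E) ((cplx J + cplx ΔJ - cplx R - cplx ΔR) * cplx Q) 0 ↔
        IsEigenvalue (cplx E) (cplx (J - R) * cplx Q) 0) ∧
      (IsEigenvalue (cplx E) (cplx (J - R) * cplx Q) 0 →
        IsSemisimpleEigenvalue (cplx E)
          ((cplx J + cplx ΔJ - cplx R - cplx ΔR) * cplx Q) 0) := by
  obtain ⟨hU1, hU2⟩ := hform.unitary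
  have hU1' : Uᴴᴴ * Uᴴ = 1 := by rw [conjTranspose_conjTranspose, hU1]
  have hRt : (U * R * Uᴴ).PosSemidef := hR.mul_mul_conjTranspose_same U
  obtain ⟨K, hK, hKpsd, hKnorm⟩ := exists_posSemidef_add_hermitianPerturbation hRt hY
  -- The projection fixes `Q₂`, so `N Q₂ = -(L₃ + Ŷ) Q₂`, while the component of `L₃ᴴ + Ŷᴴ`
  -- orthogonal to `im Q₂` does not enter the norm.
  obtain ⟨N, hN⟩ : ∃ N, N = -(projMatrix (im (col2 (U * Q * X))) *
    ((row3 (U * (J - R) * Uᴴ))ᴴ + (padRow Y)ᴴ))ᴴ := ⟨_, rfl⟩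
  have hNQ : row3 (U * (J - R) * Uᴴ) * col2 (U * Q * X) + N * col2 (U * Q * X) +
      padRow Y * col2 (U * Q * X) = 0 := by
    rw [hN, conjTranspose_mul, (projMatrix_isHermitian _).eq, Matrix.neg_mul,
      Matrix.mul_assoc _ (projMatrix _), projMatrix_im_mul, conjTranspose_add, conjTranspose_conjTranspose,
      conjTranspose_conjTranspose, Matrix.add_mul]
    abel
  have hequiv := hform.perturbed_pencilEquiv N Y K
  -- At `s = t = 0` the family gives the decoupling of the unperturbed pencil, with the same first
  -- summand.
  have hequiv0 := hequiv 0 0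
  rw [zero_smul, zero_smul, zero_smul, zero_smul, add_zero, add_zero, add_zero, sub_zero,
    ← cplx_sub] at hequiv0
  have hA0 := (hform.A11.cplx).fromBlocks_upper hform.A44.cplx
    (cplx (blk (U * ((J - R) * Q) * X) 0 3))
  have hnil (B : Matrix (Fin (d 2)) (Fin (d 1)) ℂ) :
      IsNilpotent (fromBlocks 0 0 B 0 : Matrix (Fin (d 1) ⊕ Fin (d 2)) (Fin (d 1) ⊕ Fin (d 2)) ℂ) :=
    ⟨2, by simp [pow_two, fromBlocks_multiply]⟩
  obtain ⟨κ, hκ, -⟩ := hind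
  have hone : (cplx J + cplx (Uᴴ * skewPerturbation N * U) - cplx R -
      cplx (Uᴴ * hermitianPerturbation Y K * U)) * cplx Q =
      (cplx J + (1 : ℂ) • cplx (Uᴴ * skewPerturbation N * U) - cplx R -
        (1 : ℂ) • cplx (Uᴴ * hermitianPerturbation Y K * U)) * cplx Q := by
    rw [one_smul, one_smul]
  have hiff : IsEigenvalue (cplx E) ((cplx J + cplx (Uᴴ * skewPerturbation N * U) - cplx R -
        cplx (Uᴴ * hermitianPerturbation Y K * U)) * cplx Q) 0 ↔
      IsEigenvalue (cplx E) (cplx (J - R) * cplx Q) 0 := by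
    rw [hone, (hequiv 1 1).isEigenvalue_zero_iff hA0 (hnil _),
      hequiv0.isEigenvalue_zero_iff hA0 (hnil _)]
  refine ⟨Uᴴ * hermitianPerturbation Y K * U, Uᴴ * skewPerturbation N * U, ?_, ?_, ?_, ?_, ?_,
    fun s t => ⟨(hequiv s t).isRegular hA0 (hnil _),
      (kroneckerStructure_of_decoupled hA0 hκ hequiv0 (hequiv s t)).1⟩, hiff, fun h0 =>
      ⟨hiff.mpr h0, ?_⟩⟩
  · simp only [conjTranspose_mul, conjTranspose_conjTranspose,
      hermitianPerturbation_isHermitian Y hK, Matrix.mul_assoc]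
  · have h1 : R + Uᴴ * hermitianPerturbation Y K * U =
        Uᴴ * (U * R * Uᴴ + hermitianPerturbation Y K) * Uᴴᴴ := by
      have h2 : Uᴴ * (U * R * Uᴴ) * U = R := by
        calc Uᴴ * (U * R * Uᴴ) * U = Uᴴ * U * R * (Uᴴ * U) := by simp only [Matrix.mul_assoc]
          _ = R := by rw [hU2, Matrix.one_mul, Matrix.mul_one]
      rw [conjTranspose_conjTranspose, Matrix.mul_add, Matrix.add_mul, h2]
    rw [h1]
    exact hKpsd.mul_mul_conjTranspose_same _
  · exact opNorm_conj_hermitianPerturbation_le hU1 (normInvOnIm_nonneg _) (normInvOnIm_nonneg _)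
      (opNorm_nonneg _) hKnorm
  · simp only [conjTranspose_mul, conjTranspose_conjTranspose, skewPerturbation_conjTranspose,
      Matrix.mul_assoc, Matrix.neg_mul, Matrix.mul_neg]
  · have h1 : frobNorm (Uᴴ * skewPerturbation N * U) = frobNorm (skewPerturbation N) := by
      have h2 := frobNorm_mul_of_isometry_right hU1' (Uᴴ * skewPerturbation N)
      rw [conjTranspose_conjTranspose] at h2
      rw [h2, frobNorm_mul_of_isometry_left hU1']
    rw [h1]
    refine (frobNorm_skewPerturbation_le N).trans_eq ?_
    rw [hN, frobNorm_neg, frobNorm_conjTranspose]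
  · rw [hone]
    -- Semisimplicity amounts to the vanishing of the block `B` at `s = t = 1`, which is `hNQ`.
    refine (kroneckerStructure_of_decoupled hA0 hκ hequiv0 (hequiv 1 1)).2 ?_
    rw [one_smul, one_smul, ← cplx_add, ← cplx_add, hNQ, cplx_zero]
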